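/- **Models.** All algorithms are deterministic and work in rounds: in each round a batch of queries is submitted, which may depend only on the answers from earlier rounds. *Sorting with rank queries.* The input is a list $x_1,\dots,x_n$ of distinct elements of a linear order, accessed only by queries "how is $\mathrm{rank}(x_i)$ compared to $m$?" with answer $<$, $=$ or $>$. The output is the list of indices in sorted order. *Proportional cake cutting with contiguous pieces (Robertson–Webb model).* The cake is $[0,1]$; each player $i\in\{1,\dots,n\}$ has a valuation $V_i(I)=\int_I v_i$ with $v_i\ge 0$ integrable and $V_i([0,1])=1$. The queries are $\mathrm{Cut}_i(\alpha)$ with $\alpha\in[0,1]$, which returns the leftmost $y$ with $V_i([0,y])=\alpha$ and makes $y$ a cut point, and $\mathrm{Eval}_i(y)$, which returns $V_i([0,y])$ for a cut point $y$ made in an earlier round. The output is a partition of $[0,1]$ into $n$ intervals, with boundaries among $0$, $1$ and the cut points made, together with an assignment of one interval to each player, such that each player $i$ values its own interval at least $1/n$ by $V_i$. An algorithm *solves* one of these problems in $k$ rounds with $q$ queries if on every input it gives a correct output, uses at most $k$ rounds, and issues at most $q$ queries in total. **Theorem.** The two problems are equivalent in query complexity for every number of rounds: 1. There is a polynomial-time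 reduction from sorting to proportional cake cutting that preserves the number of rounds and the number of queries. That is, there are a fixed real random access machine (unit-cost exact arithmetic and comparisons on reals, no rounding operation), independent of $n$ and $k$, and a constant $d$ such that for all $n,k\ge 1$, all $q$, and every Robertson–Webb protocol $P$ that computes proportional allocations with contiguous pieces for $n$ players in $k$ rounds with $q$ queries, the following holds. Interacting with $P$, the machine translates each query of $P$ into one rank query, in the same round, and turns the answer into an answer for $P$. When $P$ stops, the left-to-right order in which $P$ allocates the cake to the players is the sorted order of the items. The result is an algorithm that sorts $n$ items in $k$ rounds with $q$ rank queries. On every input, the total number of steps of the machine is at most $d\,(n+m)^d$, where $m$ is the number of queries issued on that input. 2. There is a universal constant $c$ such that for all $n,k\ge1$ and all $q$: if $n$ items can be sorted in $k$ rounds with $q$ rank queries, then a proportional allocation with contiguous pieces for $n$ players can be computed in the Robertson–Webb model in $k$ rounds with $c\,q$ queries. -/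

import Mathlib

open MeasureTheory

noncomputable section

namespace CakeSort

/-! ### Deterministic query algorithms that work in rounds -/

/-- A deterministic algorithm with queries in `Q`, answers in `A` and outputs in `O`. Either it
stops with an output, or it submits a whole batch `qs` of queries at once and goes on with a
continuation that depends on the list of answers (in the order of the queries). -/
inductive RoundAlg (Q A O : Type) : Type where
  | done (o : O) : RoundAlg Q A O
  | round (qs : List Q) (next : List A → RoundAlg Q A O) : RoundAlg Q A O

namespace RoundAlg

variable {Q A O : Type}

/-- The output when the queries are answered by `f`. -/
def output (f : Q → A) : RoundAlg Q A O → O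
  | done o => o
  | round qs next => output f (next (qs.map f))

/-- The number of rounds used when the queries are answered by `f`. -/
def rounds (f : Q → A) : RoundAlg Q A O → ℕ
  | done _ => 0
  | round qs next => 1 + rounds f (next (qs.map f))

/-- The total number of queries issued when the queries are answered by `f`. -/
def queries (f : Q → A) : RoundAlg Q A O → ℕ
  | done _ => 0
  | round qs next => qs.length + queries f (next (qs.map f))

end RoundAlg

/-! ### Sorting with rank queries -/

/-- The query "How is `rank (x item)` compared to `threshold`?". -/
structure RankQuery (n : ℕ) where
  item : Fin n
  threshold : ℕ

/-- The rank of `x i` in the list `x 0, …, x (n-1)`: the smallest item has rank `1`. -/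
def rank {n : ℕ} (x : Fin n → ℝ) (i : Fin n) : ℕ :=
  (Finset.univ.filter fun j => x j ≤ x i).card

/-- The answer `<`, `=` or `>` to a rank query. -/
def rankOracle {n : ℕ} (x : Fin n → ℝ) (r : RankQuery n) : Ordering :=
  compare (rank x r.item) r.threshold

/-- Algorithms in the rank query model; the output `σ` lists the items in sorted order,
`σ 0` being (the index of) the smallest one. -/
abbrev SortAlg (n : ℕ) : Type := RoundAlg (RankQuery n) Ordering (Equiv.Perm (Fin n))

/-- `S` sorts every list of `n` distinct items in at most `k` rounds and with at most `q` rank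
queries in total. -/
def SortAlg.Solves {n : ℕ} (S : SortAlg n) (k q : ℕ) : Prop :=
  ∀ x : Fin n → ℝ, Function.Injective x →
    StrictMono (fun j => x (S.output (rankOracle x) j)) ∧
    S.rounds (rankOracle x) ≤ k ∧ S.queries (rankOracle x) ≤ q

/-! ### Cake cutting in the Robertson-Webb model -/

/-- A valuation of the cake `[0,1]`: a non-negative integrable density of total value `1`. -/
structure Valuation where
  density : ℝ → ℝ
  nonneg : ∀ x ∈ Set.Icc (0 : ℝ) 1, 0 ≤ density x
  integrable : IntegrableOn density (Set.Icc 0 1)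
  total : ∫ x in Set.Icc (0 : ℝ) 1, density x = 1

/-- The value of a piece of cake. -/
def Valuation.value (V : Valuation) (I : Set ℝ) : ℝ := ∫ x in I, V.density x

/-- The answer to a cut query: the leftmost `y` such that `[0,y]` has value `α`. -/
def Valuation.cutPoint (V : Valuation) (α : ℝ) : ℝ :=
  sInf {y | y ∈ Set.Icc (0 : ℝ) 1 ∧ V.value (Set.Icc 0 y) = α}

/-- An allocation of the cake with contiguous pieces: the cake is cut at
`0 = bdry 0 ≤ bdry 1 ≤ … ≤ bdry n = 1`, and the `j`-th interval from the left goes to the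
player `order j`. -/
structure Allocation (n : ℕ) where
  order : Equiv.Perm (Fin n)
  bdry : Fin (n + 1) → ℝ
  mono : Monotone bdry
  first : bdry 0 = 0
  last : bdry (Fin.last n) = 1

/-- The interval at position `j`; only the last one contains its right end, so that the
intervals partition `[0,1]`. -/
def Allocation.slice {n : ℕ} (A : Allocation n) (j : Fin n) : Set ℝ :=
  if (j : ℕ) + 1 = n then Set.Icc (A.bdry j.castSucc) (A.bdry j.succ)
  else Set.Ico (A.bdry j.castSucc) (A.bdry j.succ)

/-- The piece that player `i` receives. -/
def Allocation.piece {n : ℕ} (A : Allocation n) (i : Fin n) : Set ℝ :=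
  A.slice (A.order.symm i)

/-- Every player receives at least `1/n` of the cake by the player's own valuation. -/
def Allocation.Proportional {n : ℕ} (A : Allocation n) (V : Fin n → Valuation) : Prop :=
  ∀ i, 1 / (n : ℝ) ≤ (V i).value (A.piece i)

/-- Robertson-Webb queries: `cut i α` asks player `i` for the leftmost `y` with
`V i [0,y] = α`, and `eval i y` asks player `i` for `V i [0,y]`. -/
inductive RWQuery (n : ℕ) : Type where
  | cut (i : Fin n) (α : ℝ) : RWQuery n
  | eval (i : Fin n) (y : ℝ) : RWQuery n

/-- The answers of the players. -/
def rwOracle {n : ℕ} (V : Fin n → Valuation) : RWQuery n → ℝ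
  | .cut i α => (V i).cutPoint α
  | .eval i y => (V i).value (Set.Icc 0 y)

/-- Robertson-Webb protocols that output an allocation with contiguous pieces. -/
abbrev RWProtocol (n : ℕ) : Type := RoundAlg (RWQuery n) ℝ (Allocation n)

/-- A query is admissible if it cuts at a value in `[0,1]`, or evaluates at a cut point made in
an earlier round. -/
def RWQuery.Admissible {n : ℕ} (cuts : Set ℝ) : RWQuery n → Prop
  | .cut _ α => α ∈ Set.Icc (0 : ℝ) 1
  | .eval _ y => y ∈ cuts

/-- The run of the protocol on the valuations `V`, when the points in `cuts` were cut before,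
obeys the rules: all queries are admissible, and the final allocation is demarcated by the ends
of the cake and by cut points made during the run. -/
def RWProtocol.Legal {n : ℕ} (V : Fin n → Valuation) : Set ℝ → RWProtocol n → Prop
  | cuts, .done A => ∀ j, A.bdry j = 0 ∨ A.bdry j = 1 ∨ A.bdry j ∈ cuts
  | cuts, .round qs next =>
      (∀ q ∈ qs, q.Admissible cuts) ∧
      RWProtocol.Legal V
        (cuts ∪ {y | ∃ i α, RWQuery.cut i α ∈ qs ∧ y = (V i).cutPoint α})
        (next (qs.map (rwOracle V)))

/-- `P` is a Robertson-Webb protocol that computes a proportional allocation with contiguous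
pieces for all `n` players, in at most `k` rounds and with at most `q` queries in total. -/
def RWProtocol.Solves {n : ℕ} (P : RWProtocol n) (k q : ℕ) : Prop :=
  ∀ V : Fin n → Valuation,
    RWProtocol.Legal V ∅ P ∧ (P.output (rwOracle V)).Proportional V ∧
    P.rounds (rwOracle V) ≤ k ∧ P.queries (rwOracle V) ≤ q

/-! ### Real random access machines with a step count -/

/-- The memory: countably many registers, each of which holds a real number. -/
abbrev Mem : Type := ℕ → ℝ

inductive Arith : Type where
  | plus | minus | times | over

/-- Programs of a real random access machine. -/
inductive Cmd : Type where
  | skip : Cmd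
  /-- `M[d] := c` -/
  | const (d : ℕ) (c : ℤ) : Cmd
  /-- `M[d] := M[a] o M[b]` -/
  | arith (o : Arith) (d a b : ℕ) : Cmd
  /-- `M[d] := M[M[a]]` -/
  | load (d a : ℕ) : Cmd
  /-- `M[M[a]] := M[s]` -/
  | store (a s : ℕ) : Cmd
  | seq (c₁ c₂ : Cmd) : Cmd
  /-- if `M[a] ≤ M[b]` then `c₁` else `c₂` -/
  | cond (a b : ℕ) (c₁ c₂ : Cmd) : Cmd
  /-- while `M[a] < M[b]` do `c` -/
  | loop (a b : ℕ) (c : Cmd) : Cmd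

/-- The result of an arithmetic operation, if it is defined: there is no division by `0`. -/
inductive Arith.Eval : Arith → ℝ → ℝ → ℝ → Prop where
  | plus (u v : ℝ) : Arith.Eval .plus u v (u + v)
  | minus (u v : ℝ) : Arith.Eval .minus u v (u - v)
  | times (u v : ℝ) : Arith.Eval .times u v (u * v)
  | over (u v : ℝ) (hv : v ≠ 0) : Arith.Eval .over u v (u / v)

/-- `Cmd.Runs c M t M'`: the program `c`, started with memory `M`, stops after `t` steps with
memory `M'`. An indirect access needs an address that is a natural number. -/
inductive Cmd.Runs : Cmd → Mem → ℕ → Mem → Prop where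
  | skip (M : Mem) : Cmd.Runs .skip M 1 M
  | const (M : Mem) (d : ℕ) (c : ℤ) : Cmd.Runs (.const d c) M 1 (Function.update M d (c : ℝ))
  | arith (M : Mem) (o : Arith) (d a b : ℕ) (r : ℝ) (h : o.Eval (M a) (M b) r) :
      Cmd.Runs (.arith o d a b) M 1 (Function.update M d r)
  | load (M : Mem) (d a j : ℕ) (h : M a = (j : ℝ)) :
      Cmd.Runs (.load d a) M 1 (Function.update M d (M j))
  | store (M : Mem) (a s j : ℕ) (h : M a = (j : ℝ)) :
      Cmd.Runs (.store a s) M 1 (Function.update M j (M s))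
  | seq (c₁ c₂ : Cmd) (M M₁ M₂ : Mem) (t₁ t₂ : ℕ) (h₁ : Cmd.Runs c₁ M t₁ M₁)
      (h₂ : Cmd.Runs c₂ M₁ t₂ M₂) : Cmd.Runs (.seq c₁ c₂) M (t₁ + t₂) M₂
  | condTrue (a b : ℕ) (c₁ c₂ : Cmd) (M M' : Mem) (t : ℕ) (h : M a ≤ M b)
      (h₁ : Cmd.Runs c₁ M t M') : Cmd.Runs (.cond a b c₁ c₂) M (1 + t) M'
  | condFalse (a b : ℕ) (c₁ c₂ : Cmd) (M M' : Mem) (t : ℕ) (h : ¬ M a ≤ M b)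
      (h₂ : Cmd.Runs c₂ M t M') : Cmd.Runs (.cond a b c₁ c₂) M (1 + t) M'
  | loopExit (a b : ℕ) (c : Cmd) (M : Mem) (h : ¬ M a < M b) : Cmd.Runs (.loop a b c) M 1 M
  | loopStep (a b : ℕ) (c : Cmd) (M M₁ M₂ : Mem) (t₁ t₂ : ℕ) (h : M a < M b)
      (h₁ : Cmd.Runs c M t₁ M₁) (h₂ : Cmd.Runs (.loop a b c) M₁ t₂ M₂) :
      Cmd.Runs (.loop a b c) M (1 + t₁ + t₂) M₂

/-! ### Reductions from sorting to cake cutting -/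

/-- A reduction consists of two programs that share one memory. The program `ask` translates a
Robertson-Webb query into a rank query; `answer` turns the answer of that rank query
into an answer to the Robertson-Webb query. Neither program depends on the number of players. -/
structure Reduction where
  ask : Cmd
  answer : Cmd

/-- At the start register `0` holds `n` and all other registers hold `0`. -/
def initMem (n : ℕ) : Mem := Function.update (fun _ => 0) 0 (n : ℝ)

/-- A Robertson-Webb query is written into the registers `1` (its kind: `0` for cut and `1` for
eval), `2` (the player) and `3` (the real parameter). -/
def loadQuery {n : ℕ} (M : Mem) : RWQuery n → Mem
  | .cut i α =>
      Function.update (Function.update (Function.update M 1 0) 2 ((i : ℕ) : ℝ)) 3 α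
  | .eval i y =>
      Function.update (Function.update (Function.update M 1 1) 2 ((i : ℕ) : ℝ)) 3 y

def orderingCode : Ordering → ℝ
  | .lt => -1
  | .eq => 0
  | .gt => 1

/-- The answer of a rank query is written into register `4`. -/
def loadAnswer (M : Mem) (o : Ordering) : Mem := Function.update M 4 (orderingCode o)

/-- The first half of a round: `ask` translates the batch `qs`, one query after the other, into
the batch `rs` of rank queries, which it leaves in the registers `5` (item) and `6`
(threshold). No answers are known at this time. -/
inductive AskAll (c : Cmd) {n : ℕ} :
    List (RWQuery n) → Mem → List (RankQuery n) → ℕ → Mem → Prop where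
  | nil (M : Mem) : AskAll c [] M [] 0 M
  | cons (q : RWQuery n) (qs : List (RWQuery n)) (r : RankQuery n) (rs : List (RankQuery n))
      (M M₁ M₂ : Mem) (t₁ t₂ : ℕ)
      (h : c.Runs (loadQuery M q) t₁ M₁)
      (hitem : M₁ 5 = ((r.item : ℕ) : ℝ)) (hthr : M₁ 6 = (r.threshold : ℝ))
      (hs : AskAll c qs M₁ rs t₂ M₂) :
      AskAll c (q :: qs) M (r :: rs) (t₁ + t₂) M₂

/-- The second half of a round: `answer` is given the queries of the batch again, each with the
answer of its rank query, and computes the answers `as` to the Robertson-Webb queries,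
which it leaves in register `7`. -/
inductive AnswerAll (c : Cmd) {n : ℕ} :
    List (RWQuery n × Ordering) → Mem → List ℝ → ℕ → Mem → Prop where
  | nil (M : Mem) : AnswerAll c [] M [] 0 M
  | cons (q : RWQuery n) (o : Ordering) (qs : List (RWQuery n × Ordering)) (as : List ℝ)
      (M M₁ M₂ : Mem) (t₁ t₂ : ℕ)
      (h : c.Runs (loadAnswer (loadQuery M q) o) t₁ M₁)
      (hs : AnswerAll c qs M₁ as t₂ M₂) :
      AnswerAll c ((q, o) :: qs) M (M₁ 7 :: as) (t₁ + t₂) M₂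

/-- `Reduction.Executes R f P S M t`: if the rank queries are answered by `f`, then the run of
the sorting algorithm `S` is what the reduction `R`, started with memory `M`, makes of the
cake cutting protocol `P`, and the programs of `R` take `t` steps altogether. Each round of `P`
becomes one round of `S`, each query of `P` becomes one query of `S`, and the output of `S` is
the order, from left to right, in which `P` allocates the cake to the players. -/
inductive Reduction.Executes (R : Reduction) {n : ℕ} (f : RankQuery n → Ordering) :
    RWProtocol n → SortAlg n → Mem → ℕ → Prop where
  | done (A : Allocation n) (M : Mem) :
      Reduction.Executes R f (.done A) (.done A.order) M 0
  | round (qs : List (RWQuery n)) (nextP : List ℝ → RWProtocol n)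
      (rs : List (RankQuery n)) (nextS : List Ordering → SortAlg n) (as : List ℝ)
      (M M₁ M₂ : Mem) (t₁ t₂ t₃ : ℕ)
      (hask : AskAll R.ask qs M rs t₁ M₁)
      (hanswer : AnswerAll R.answer (qs.zip (rs.map f)) M₁ as t₂ M₂)
      (hnext : Reduction.Executes R f (nextP as) (nextS (rs.map f)) M₂ t₃) :
      Reduction.Executes R f (.round qs nextP) (.round rs nextS) M (t₁ + t₂ + t₃)

end CakeSort

end

noncomputable section

namespace CakeSort

/-! Part 1: the protocol is confronted with players who encode the ranks. The cake has `n + 1` zones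
of equal length, each worth `1 / (n + 1)` to everybody. In zone `j`, counted from 0, a player of
rank `s` likes only the left, middle or right third, according as `s` is less than, equal to or
greater than `j + 1`. An answer inside a zone depends on the player only through this comparison, so
one rank query settles one Robertson–Webb query (`rwOracle_hardPlayers`). A share of `1 / n` is
worth more than a zone, which forces the `t`-th boundary of a proportional allocation into zone `t`.
There the thirds liked by the two neighbours show that a player whose rank is too high for its
position is followed by another such player, which is impossible at the right end. Hence the pieces
are ordered by rank (`rank_order_eq`). The machine has no rounding operation and finds the zone by
counting, in a number of steps linear in `n` per query.

Part 2: the sorting algorithm is not simulated; an explicit protocol is compared with a lower bound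
for sorting. The protocol divides every group of players into `z` parts per round, by `z - 1` cut
queries per player, and so needs `J` rounds and `J * (n * (z - 1))` queries whenever `n ≤ z ^ J`
(`Blocks.exists_protocol`).

For the lower bound, a batch with `c i` queries about item `i` has at most `∏ i, (2 * c i + 1)`
lists of answers, since the answers about one item only reveal where its rank lies among the
thresholds. As `n!` inputs must be told apart, bounding this product by a power of 3 gives a bound
of order `n log n` (`SortAlg.Solves.mul_log_le`), and bounding it by a tangent to the exponential
gives one of order `k n ^ (1 + 1 / k)` when `n ^ (1 / k)` is large (`SortAlg.Solves.mul_mul_le`).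
With `z` minimal such that `n ≤ z ^ k`, the two sides agree up to a constant. -/

/-! ### A lower bound for sorting with rank queries -/

/-- An algorithm with at most `k` rounds and `q` queries distinguishes at most `a ^ k * b ^ q`
inputs if every batch `qs` has at most `a * b ^ qs.length` lists of answers. -/
theorem RoundAlg.card_le {Q A O X : Type} [DecidableEq A] (f : X → Q → A) {a b : ℝ}
    (ha : 1 ≤ a) (hb : 1 ≤ b)
    (hans : ∀ (qs : List Q) (s : Finset X),
      ((s.image fun x => qs.map (f x)).card : ℝ) ≤ a * b ^ qs.length)
    (S : RoundAlg Q A O) : ∀ (s : Finset X) (k q : ℕ),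
      (∀ x ∈ s, S.rounds (f x) ≤ k) → (∀ x ∈ s, S.queries (f x) ≤ q) →
      Set.InjOn (fun x => S.output (f x)) s → (s.card : ℝ) ≤ a ^ k * b ^ q := by
  induction S with
  | done o =>
    intro s k q _ _ hinj
    have h1 : s.card ≤ 1 := Finset.card_le_one.2 fun x hx y hy => hinj hx hy rfl
    have h2 : (1 : ℝ) ≤ a ^ k * b ^ q :=
      one_le_mul_of_one_le_of_one_le (one_le_pow₀ ha) (one_le_pow₀ hb)
    exact le_trans (by exact_mod_cast h1) h2
  | round qs next ih =>
    intro s k q hk hq hinj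
    rcases s.eq_empty_or_nonempty with rfl | ⟨x₀, hx₀⟩
    · simp only [Finset.card_empty, Nat.cast_zero]
      positivity
    obtain ⟨k, rfl⟩ : ∃ k', k = k' + 1 := by
      have := hk x₀ hx₀
      simp only [RoundAlg.rounds] at this
      exact ⟨k - 1, by omega⟩
    obtain ⟨q, rfl⟩ : ∃ q', q = qs.length + q' := by
      have := hq x₀ hx₀
      simp only [RoundAlg.queries] at this
      exact ⟨q - qs.length, by omega⟩
    -- Inputs with the same answers to the first batch share the continuation, to which the
    -- induction hypothesis applies.
    rw [Finset.card_eq_sum_card_image (fun x => qs.map (f x)) s]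
    push_cast
    calc _ ≤ ∑ _as ∈ s.image (fun x => qs.map (f x)), a ^ k * b ^ q := by
          refine Finset.sum_le_sum fun as _ => ih as _ k q ?_ ?_ ?_
          · intro x hx
            obtain ⟨hxs, rfl⟩ := Finset.mem_filter.1 hx
            have := hk x hxs
            simp only [RoundAlg.rounds] at this
            omega
          · intro x hx
            obtain ⟨hxs, rfl⟩ := Finset.mem_filter.1 hx
            have := hq x hxs
            simp only [RoundAlg.queries] at this
            omega
          · intro x hx y hy hxy
            obtain ⟨hxs, rfl⟩ := Finset.mem_filter.1 (Finset.mem_coe.1 hx)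
            obtain ⟨hys, hy'⟩ := Finset.mem_filter.1 (Finset.mem_coe.1 hy)
            refine hinj hxs hys ?_
            simp only [RoundAlg.output]
            rw [hy']
            exact hxy
      _ ≤ (a * b ^ qs.length) * (a ^ k * b ^ q) := by
          rw [Finset.sum_const, nsmul_eq_mul]
          exact mul_le_mul_of_nonneg_right (hans qs s) (by positivity)
      _ = _ := by ring

/-- The number of queries of a batch about item `i`. -/
def itemCount {n : ℕ} (qs : List (RankQuery n)) (i : Fin n) : ℕ :=
  qs.countP fun r => decide (r.item = i)

theorem sum_itemCount {n : ℕ} (qs : List (RankQuery n)) :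
    ∑ i, itemCount qs i = qs.length := by
  induction qs with
  | nil => simp [itemCount]
  | cons r qs ih =>
    have : ∀ i, itemCount (r :: qs) i = itemCount qs i + if r.item = i then 1 else 0 := by
      intro i
      simp [itemCount, List.countP_cons]
    simp [this, Finset.sum_add_distrib, ih]

/-- Encodes the answers of a batch to all queries about item `i`, if this item has rank `r`. -/
def itemCode {n : ℕ} (qs : List (RankQuery n)) (i : Fin n) (r : ℕ) : ℕ :=
  (qs.countP fun s => decide (s.item = i ∧ s.threshold < r)) +
    qs.countP fun s => decide (s.item = i ∧ s.threshold ≤ r)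

theorem itemCode_le {n : ℕ} (qs : List (RankQuery n)) (i : Fin n) (r : ℕ) :
    itemCode qs i r ≤ 2 * itemCount qs i := by
  rw [two_mul]
  refine Nat.add_le_add ?_ ?_ <;>
  · refine List.countP_mono_left fun s _ h => ?_
    simp only [decide_eq_true_eq] at h ⊢
    exact h.1

/-- A stronger predicate that counts as many elements of a list cannot miss any of those counted by
the weaker one. -/
theorem countP_eq_imp {α : Type} {p p' : α → Bool} (l : List α)
    (hpp : ∀ a, p a = true → p' a = true) (h : l.countP p = l.countP p') :
    ∀ a ∈ l, p a = p' a := by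
  induction l with
  | nil => simp
  | cons b l ih =>
    have hle : l.countP p ≤ l.countP p' := List.countP_mono_left fun s _ => hpp s
    simp only [List.countP_cons] at h
    have hb := hpp b
    intro a ha
    cases hp : p b <;> cases hp' : p' b <;> simp [hp, hp'] at h hb <;>
      first
      | omega
      | (rcases List.mem_cons.1 ha with rfl | ha
         · rw [hp, hp']
         · exact ih h a ha)

/-- Both counts in the code grow with the rank, so equality of the sums forces equality of each;
then no threshold is reached or passed between `r` and `r'`. -/
theorem compare_eq_of_itemCode_eq {n : ℕ} (qs : List (RankQuery n)) (i : Fin n) {r r' : ℕ}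
    (hrr : r ≤ r') (h : itemCode qs i r = itemCode qs i r') :
    ∀ s ∈ qs, s.item = i → compare r s.threshold = compare r' s.threshold := by
  have m₁ : ∀ s : RankQuery n, decide (s.item = i ∧ s.threshold < r) = true →
      decide (s.item = i ∧ s.threshold < r') = true := by
    intro s; simp only [decide_eq_true_eq]; omega
  have m₂ : ∀ s : RankQuery n, decide (s.item = i ∧ s.threshold ≤ r) = true →
      decide (s.item = i ∧ s.threshold ≤ r') = true := by
    intro s; simp only [decide_eq_true_eq]; omega
  have c₁ := List.countP_mono_left (l := qs) fun s _ => m₁ s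
  have c₂ := List.countP_mono_left (l := qs) fun s _ => m₂ s
  unfold itemCode at h
  intro s hs hi
  have e₁ := countP_eq_imp qs m₁ (by omega) s hs
  have e₂ := countP_eq_imp qs m₂ (by omega) s hs
  simp only [hi, true_and, decide_eq_decide] at e₁ e₂
  rcases lt_trichotomy r s.threshold with h1 | h1 | h1
  · rw [compare_lt_iff_lt.2 h1, compare_lt_iff_lt.2 (by omega)]
  · rw [compare_eq_iff_eq.2 h1, compare_eq_iff_eq.2 (by omega)]
  · rw [compare_gt_iff_gt.2 h1, compare_gt_iff_gt.2 (by omega)]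

/-- The codes of all items determine the list of answers, and the code of item `i` is one of `0, …,
2 * itemCount qs i`. -/
theorem card_answers_le {n : ℕ} {X : Type} (x : X → Fin n → ℝ) (qs : List (RankQuery n))
    (s : Finset X) :
    (s.image fun y => qs.map (rankOracle (x y))).card ≤ ∏ i, (2 * itemCount qs i + 1) := by
  classical
  have h1 : (s.image fun y => qs.map (rankOracle (x y))).card ≤
      (s.image fun y i => itemCode qs i (rank (x y) i)).card := by
    refine Finset.card_le_card_of_surjOn
      (fun g => if h : ∃ y ∈ s, (fun i => itemCode qs i (rank (x y) i)) = g
        then qs.map (rankOracle (x h.choose)) else []) ?_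
    intro as has
    obtain ⟨y, hy, rfl⟩ := Finset.mem_image.1 (Finset.mem_coe.1 has)
    refine ⟨fun i => itemCode qs i (rank (x y) i),
      Finset.mem_coe.2 (Finset.mem_image.2 ⟨y, hy, rfl⟩), ?_⟩
    have hex : ∃ y' ∈ s, (fun i => itemCode qs i (rank (x y') i)) =
      fun i => itemCode qs i (rank (x y) i) := ⟨y, hy, rfl⟩
    simp only [dif_pos hex]
    refine List.map_congr_left fun r hr => ?_
    have := congrFun hex.choose_spec.2 r.item
    rcases le_total (rank (x hex.choose) r.item) (rank (x y) r.item) with h | h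
    · exact compare_eq_of_itemCode_eq qs r.item h this r hr rfl
    · exact (compare_eq_of_itemCode_eq qs r.item h this.symm r hr rfl).symm
  refine h1.trans ?_
  have h2 : (s.image fun y i => itemCode qs i (rank (x y) i)) ⊆
      Fintype.piFinset fun i => Finset.range (2 * itemCount qs i + 1) := by
    intro g hg
    obtain ⟨y, _, rfl⟩ := Finset.mem_image.1 hg
    simp only [Fintype.mem_piFinset, Finset.mem_range]
    intro i
    have := itemCode_le qs i (rank (x y) i)
    omega
  refine (Finset.card_le_card h2).trans ?_
  simp [Fintype.card_piFinset]

theorem perm_strictMono_eq_one {n : ℕ} (σ : Equiv.Perm (Fin n)) (h : StrictMono σ) : σ = 1 := by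
  have := (StrictMono.range_inj h strictMono_id).1 (by simp)
  exact Equiv.ext fun i => congrFun this i

/-- The numbers `k` and `q` of rounds and queries of a sorting algorithm satisfy
`n! ≤ a ^ k * b ^ q`. -/
theorem SortAlg.Solves.factorial_le {n : ℕ} {S : SortAlg n} {k q : ℕ} (hS : S.Solves k q)
    {a b : ℝ} (ha : 1 ≤ a) (hb : 1 ≤ b)
    (hab : ∀ qs : List (RankQuery n),
      ((∏ i, (2 * itemCount qs i + 1) : ℕ) : ℝ) ≤ a * b ^ qs.length) :
    ((Nat.factorial n : ℕ) : ℝ) ≤ a ^ k * b ^ q := by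
  let x : Equiv.Perm (Fin n) → Fin n → ℝ := fun π i => ((π i : ℕ) : ℝ)
  have hx : ∀ π, Function.Injective (x π) := by
    intro π i j hij
    have : (π i : ℕ) = (π j : ℕ) := by simpa only [x, Nat.cast_inj] using hij
    exact π.injective (Fin.ext this)
  have key := RoundAlg.card_le (fun π => rankOracle (x π)) ha hb
    (fun qs s => le_trans (by exact_mod_cast card_answers_le x qs s) (hab qs)) S Finset.univ k q
    (fun π _ => (hS (x π) (hx π)).2.1) (fun π _ => (hS (x π) (hx π)).2.2) ?_
  · rw [Finset.card_univ, Fintype.card_perm, Fintype.card_fin] at key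
    exact key
  -- On the input `π` the output must be the inverse of `π`, so different permutations have
  -- different outputs.
  · have inv : ∀ π, π * S.output (rankOracle (x π)) = 1 := by
      intro π
      refine perm_strictMono_eq_one _ fun i j hij => ?_
      have := (hS (x π) (hx π)).1 hij
      simp only [x, Nat.cast_lt] at this
      exact this
    intro π _ π' _ h
    simp only at h
    have h1 := inv π
    rw [h] at h1
    exact mul_right_cancel (h1.trans (inv π').symm)

/-- Bernoulli's inequality `1 + 2 * c ≤ 3 ^ c`, applied to every item. -/
theorem prod_itemCount_le_three_pow {n : ℕ} (qs : List (RankQuery n)) :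
    ∏ i, (2 * itemCount qs i + 1) ≤ 3 ^ qs.length := by
  rw [← sum_itemCount qs, ← Finset.prod_pow_eq_pow_sum]
  refine Finset.prod_le_prod' fun i _ => ?_
  have h := one_add_mul_le_pow (a := (2 : ℤ)) (by norm_num) (itemCount qs i)
  zify
  norm_num at h
  linarith

/-- From `u ≤ exp (u - 1)` with `u = (2 * c + 1) / w`, which is sharp for `2 * c + 1 = w`. The free
parameter `w` allows tuning to batches in which each item is queried about `w / 2` times. -/
theorem prod_itemCount_le_exp {n : ℕ} (qs : List (RankQuery n)) {w : ℝ} (hw : 0 < w) :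
    ((∏ i, (2 * itemCount qs i + 1) : ℕ) : ℝ) ≤
      (w * Real.exp (1 / w - 1)) ^ n * Real.exp (2 / w) ^ qs.length := by
  have h1 : ∀ i, ((2 * itemCount qs i + 1 : ℕ) : ℝ) ≤
      (w * Real.exp (1 / w - 1)) * Real.exp (2 / w) ^ itemCount qs i := by
    intro i
    have h := Real.add_one_le_exp ((2 * itemCount qs i + 1 : ℝ) / w - 1)
    have h2 : (2 * itemCount qs i + 1 : ℝ) / w ≤
        Real.exp (1 / w - 1) * Real.exp (2 / w) ^ itemCount qs i := by
      rw [← Real.exp_nat_mul, ← Real.exp_add]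
      refine le_trans (by linarith) (h.trans (Real.exp_le_exp.2 (le_of_eq ?_)))
      field_simp
      ring
    rw [div_le_iff₀ hw] at h2
    push_cast
    linarith
  push_cast
  push_cast at h1
  calc _ ≤ ∏ i : Fin n, (w * Real.exp (1 / w - 1)) * Real.exp (2 / w) ^ itemCount qs i :=
        Finset.prod_le_prod (fun i _ => by positivity) fun i _ => h1 i
    _ = _ := by
        rw [Finset.prod_mul_distrib, Finset.prod_pow_eq_pow_sum, sum_itemCount]
        simp

/-- Sorting takes at least `n log n / 4` rank queries. -/
theorem SortAlg.Solves.mul_log_le {n : ℕ} {S : SortAlg n} {k q : ℕ} (hS : S.Solves k q)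
    (hn : 1 ≤ n) : n * Nat.log 2 n ≤ 4 * q := by
  have h := hS.factorial_le (a := 1) (b := 3) le_rfl (by norm_num) fun qs => by
    rw [one_mul]; exact_mod_cast prod_itemCount_le_three_pow qs
  rw [one_pow, one_mul] at h
  have h : Nat.factorial n ≤ 3 ^ q := by exact_mod_cast h
  -- The factors of the square are paired as `(i + 1) * (n - i)`, and each pair is at least `n`.
  have h1 : n ^ n ≤ Nat.factorial n ^ 2 := by
    have e1 : Nat.factorial n ^ 2 = ∏ i ∈ Finset.range n, (i + 1) * (n - i) := by
      rw [Finset.prod_mul_distrib, sq, Finset.prod_range_add_one_eq_factorial]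
      congr 1
      rw [← Finset.prod_range_add_one_eq_factorial, ← Finset.prod_range_reflect]
      refine Finset.prod_congr rfl fun i hi => ?_
      have := Finset.mem_range.1 hi
      omega
    rw [e1]
    calc n ^ n = ∏ _i ∈ Finset.range n, n := by simp
      _ ≤ _ := by
        refine Finset.prod_le_prod' fun i hi => ?_
        have := Finset.mem_range.1 hi
        obtain ⟨m, rfl⟩ := Nat.exists_eq_add_of_lt this
        have : i + m + 1 - i = m + 1 := by omega
        rw [this]
        nlinarith [Nat.zero_le (i * m)]
  have h2 : 2 ^ (n * Nat.log 2 n) ≤ 2 ^ (4 * q) := by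
    calc 2 ^ (n * Nat.log 2 n) = (2 ^ Nat.log 2 n) ^ n := by rw [mul_comm, pow_mul]
      _ ≤ n ^ n := Nat.pow_le_pow_left (Nat.pow_log_le_self 2 (by omega)) n
      _ ≤ (3 ^ q) ^ 2 := h1.trans (Nat.pow_le_pow_left h 2)
      _ = 9 ^ q := by rw [← pow_mul, mul_comm, pow_mul]; norm_num
      _ ≤ 16 ^ q := Nat.pow_le_pow_left (by norm_num) q
      _ = 2 ^ (4 * q) := by rw [pow_mul]; norm_num
  exact (Nat.pow_le_pow_iff_right (by norm_num)).1 h2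

/-- Sorting in `k` rounds takes at least `k n ^ (1 + 1 / k) / 10` rank queries, if `n ^ (1 / k)`
is large. -/
theorem SortAlg.Solves.mul_mul_le {n : ℕ} {S : SortAlg n} {k q : ℕ} (hS : S.Solves k q)
    (hk : 1 ≤ k) {v : ℕ} (hv : 6 ≤ v) (hvn : v ^ k ≤ n) : k * n * v ≤ 10 * q := by
  have he := Real.exp_pos 1
  have he3 := Real.exp_one_lt_d9
  have hv' : (6 : ℝ) ≤ v := by exact_mod_cast hv
  -- With this `w`, the factor `w ^ (k * n)` equals `v ^ (k * n) * exp (-(k * n))`, so `v ^ (k * n)`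
  -- cancels against the lower bound for `n ^ n` and only exponents remain to be compared.
  set w : ℝ := v / Real.exp 1 with hwdef
  have hw : 0 < w := by positivity
  have hw1 : 1 ≤ w * Real.exp (1 / w - 1) := by
    have := Real.add_one_le_exp (1 / w - 1)
    calc 1 = w * (1 / w) := by field_simp
      _ ≤ _ := mul_le_mul_of_nonneg_left (by linarith) hw.le
  have h := hS.factorial_le (one_le_pow₀ hw1) (Real.one_le_exp (by positivity))
    fun qs => prod_itemCount_le_exp qs hw
  have h1 := Real.pow_div_factorial_le_exp (n : ℝ) (by positivity) n
  rw [div_le_iff₀ (by positivity)] at h1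
  have h2 : (v : ℝ) ^ (k * n) ≤ (n : ℝ) ^ n := by
    rw [pow_mul]
    exact pow_le_pow_left₀ (by positivity) (by exact_mod_cast hvn) n
  have h3 : (v : ℝ) ^ (k * n) ≤ v ^ (k * n) *
      Real.exp (n - k * n + (k * n) * (1 / w - 1) + q * (2 / w)) := by
    calc (v : ℝ) ^ (k * n) ≤ Real.exp n * (((w * Real.exp (1 / w - 1)) ^ n) ^ k *
          Real.exp (2 / w) ^ q) :=
        h2.trans (h1.trans (mul_le_mul_of_nonneg_left h (Real.exp_pos _).le))
      _ = _ := by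
        have hwv : w = v * Real.exp (-1) := by rw [hwdef, Real.exp_neg]; rfl
        rw [← pow_mul, mul_comm n k, mul_pow, ← Real.exp_nat_mul, ← Real.exp_nat_mul]
        nth_rewrite 1 [hwv]
        rw [mul_pow, ← Real.exp_nat_mul]
        have : Real.exp n * (v ^ (k * n) * Real.exp ((k * n : ℕ) * (-1)) *
            Real.exp ((k * n : ℕ) * (1 / w - 1)) * Real.exp (q * (2 / w))) =
            v ^ (k * n) * (Real.exp n * Real.exp ((k * n : ℕ) * (-1)) *
              Real.exp ((k * n : ℕ) * (1 / w - 1)) * Real.exp (q * (2 / w))) := by ring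
        rw [this, ← Real.exp_add, ← Real.exp_add, ← Real.exp_add]
        push_cast
        ring_nf
  have h4 : 0 ≤ (n : ℝ) - k * n + (k * n) * (1 / w - 1) + q * (2 / w) := by
    rw [← Real.one_le_exp_iff]
    exact le_of_mul_le_mul_left (by linarith) (by positivity : (0 : ℝ) < v ^ (k * n))
  have h5 : 0 ≤ ((n : ℝ) - 2 * (k * n)) * w + (k * n + 2 * q) := by
    have := mul_nonneg h4 hw.le
    have e : ((n : ℝ) - k * n + (k * n) * (1 / w - 1) + q * (2 / w)) * w =
      ((n : ℝ) - 2 * (k * n)) * w + (k * n + 2 * q) := by field_simp; ring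
    linarith
  have hkn : (n : ℝ) ≤ k * n := by
    exact_mod_cast Nat.le_mul_of_pos_left n hk
  -- Here `11 / 30 < 1 / e`. The condition `6 ≤ v` gives `k * n ≤ k * n * v / 6`, and `11 / 30 - 1 /
  -- 6 = 1 / 5` yields the constant 10.
  have hwv : (v : ℝ) * (11 / 30) ≤ w := by
    rw [hwdef, le_div_iff₀ he]
    nlinarith
  have hkn0 : (0 : ℝ) ≤ k * n := by positivity
  have h6 : (k * n : ℝ) * v ≤ 10 * q := by
    have e1 : (k * n : ℝ) * w ≤ k * n + 2 * q := by nlinarith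
    have e2 : (k * n : ℝ) * (v * (11 / 30)) ≤ k * n * w := mul_le_mul_of_nonneg_left hwv hkn0
    have e3 : (k * n : ℝ) * 6 ≤ k * n * v := mul_le_mul_of_nonneg_left hv' hkn0
    linarith
  exact_mod_cast h6

/-! ### Valuations -/

namespace Valuation

variable (V : Valuation)

theorem integrableOn_sub {a b : ℝ} (ha : 0 ≤ a) (hb : b ≤ 1) :
    IntegrableOn V.density (Set.Icc a b) :=
  V.integrable.mono_set (Set.Icc_subset_Icc ha hb)

theorem value_Icc_zero : V.value (Set.Icc 0 0) = 0 := by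
  simp [value]

theorem value_Ico (a b : ℝ) : V.value (Set.Ico a b) = V.value (Set.Icc a b) :=
  (integral_Icc_eq_integral_Ico).symm

theorem value_Icc {a b : ℝ} (ha : 0 ≤ a) (hab : a ≤ b) (hb : b ≤ 1) :
    V.value (Set.Icc a b) = V.value (Set.Icc 0 b) - V.value (Set.Icc 0 a) := by
  have h : Set.Icc 0 b = Set.Icc 0 a ∪ Set.Ioc a b := (Set.Icc_union_Ioc_eq_Icc ha hab).symm
  have hd : Disjoint (Set.Icc 0 a) (Set.Ioc a b) := by
    refine Set.disjoint_left.2 fun x hx hx' => ?_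
    exact absurd hx.2 (not_le.2 hx'.1)
  have e : V.value (Set.Icc 0 b) = V.value (Set.Icc 0 a) + V.value (Set.Ioc a b) := by
    unfold value
    rw [h, setIntegral_union hd measurableSet_Ioc (V.integrableOn_sub le_rfl (hab.trans hb))
      ((V.integrableOn_sub ha hb).mono_set Set.Ioc_subset_Icc_self)]
  have e' : V.value (Set.Icc a b) = V.value (Set.Ioc a b) := integral_Icc_eq_integral_Ioc
  linarith

theorem value_nonneg {a b : ℝ} (ha : 0 ≤ a) (hb : b ≤ 1) : 0 ≤ V.value (Set.Icc a b) :=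
  setIntegral_nonneg measurableSet_Icc fun x hx => V.nonneg x ⟨ha.trans hx.1, hx.2.trans hb⟩

theorem value_mono {a b : ℝ} (ha : 0 ≤ a) (hab : a ≤ b) (hb : b ≤ 1) :
    V.value (Set.Icc 0 a) ≤ V.value (Set.Icc 0 b) := by
  have := V.value_nonneg ha hb
  rw [V.value_Icc ha hab hb] at this
  linarith

theorem continuousOn_value : ContinuousOn (fun y => V.value (Set.Icc 0 y)) (Set.Icc 0 1) :=
  intervalIntegral.continuousOn_primitive_Icc V.integrable

/-- The infimum is attained: the level set is closed by continuity and nonempty by the intermediate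
value theorem. -/
theorem isLeast_cutPoint {α : ℝ} (hα : α ∈ Set.Icc (0 : ℝ) 1) :
    IsLeast {y | y ∈ Set.Icc (0 : ℝ) 1 ∧ V.value (Set.Icc 0 y) = α} (V.cutPoint α) := by
  have hclosed : IsClosed {y | y ∈ Set.Icc (0 : ℝ) 1 ∧ V.value (Set.Icc 0 y) = α} :=
    V.continuousOn_value.preimage_isClosed_of_isClosed isClosed_Icc isClosed_singleton
  have hne : {y | y ∈ Set.Icc (0 : ℝ) 1 ∧ V.value (Set.Icc 0 y) = α}.Nonempty := by
    have h := intermediate_value_Icc zero_le_one V.continuousOn_value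
    have h0 : V.value (Set.Icc 0 1) = 1 := V.total
    simp only [value_Icc_zero, h0] at h
    obtain ⟨y, hy, hyα⟩ := h hα
    exact ⟨y, hy, hyα⟩
  have hbdd : BddBelow {y | y ∈ Set.Icc (0 : ℝ) 1 ∧ V.value (Set.Icc 0 y) = α} :=
    ⟨0, fun y hy => hy.1.1⟩
  exact ⟨hclosed.csInf_mem hne hbdd, fun y hy => csInf_le hbdd hy⟩

theorem cutPoint_eq {α y : ℝ} (hy : y ∈ Set.Icc (0 : ℝ) 1) (h : V.value (Set.Icc 0 y) = α)
    (hlt : ∀ z, 0 ≤ z → z < y → V.value (Set.Icc 0 z) ≠ α) : V.cutPoint α = y := by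
  refine IsLeast.csInf_eq ⟨⟨hy, h⟩, fun z hz => ?_⟩
  by_contra hzy
  exact hlt z hz.1.1 (not_le.1 hzy) hz.2

end Valuation

theorem Allocation.bdry_mem {n : ℕ} (A : Allocation n) (j : Fin (n + 1)) :
    A.bdry j ∈ Set.Icc (0 : ℝ) 1 :=
  ⟨A.first ▸ A.mono (Fin.zero_le j), A.last ▸ A.mono (Fin.le_last j)⟩

theorem Allocation.value_slice {n : ℕ} (A : Allocation n) (V : Valuation) (j : Fin n) :
    V.value (A.slice j) =
      V.value (Set.Icc 0 (A.bdry j.succ)) - V.value (Set.Icc 0 (A.bdry j.castSucc)) := by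
  have h := V.value_Icc (A.bdry_mem j.castSucc).1 (A.mono (Fin.castSucc_lt_succ (i := j)).le)
    (A.bdry_mem j.succ).2
  unfold Allocation.slice
  split_ifs
  · exact h
  · rw [V.value_Ico, h]

/-! ### Splitting a group of players -/

theorem exists_lower_subset {ι : Type} [DecidableEq ι] (G : Finset ι) (y : ι → ℝ) (c : ℕ)
    (hc : c ≤ G.card) :
    ∃ L ⊆ G, L.card = c ∧ ∀ i ∈ L, ∀ j ∈ G, j ∉ L → y i ≤ y j := by
  induction c with
  | zero => exact ⟨∅, by simp⟩
  | succ c ih =>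
    obtain ⟨L, hL, hcard, hle⟩ := ih (by omega)
    have hne : (G \ L).Nonempty := by
      rw [← Finset.card_pos, Finset.card_sdiff_of_subset hL]
      omega
    obtain ⟨a, ha, hmin⟩ := Finset.exists_min_image _ y hne
    obtain ⟨haG, haL⟩ := Finset.mem_sdiff.1 ha
    refine ⟨insert a L, Finset.insert_subset haG hL, by rw [Finset.card_insert_of_notMem haL, hcard],
      fun i hi j hj hjL => ?_⟩
    rw [Finset.mem_insert, not_or] at hjL
    rcases Finset.mem_insert.1 hi with rfl | hi
    · exact hmin j (Finset.mem_sdiff.2 ⟨hj, hjL.2⟩)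
    · exact hle i hi j hj hjL.2

/-- The separating value is itself somebody's opinion, so that it is a cut point that has really
been made. It is the largest opinion in `L`, or the smallest one in `G` if `L` is empty. -/
theorem exists_split {ι : Type} [DecidableEq ι] (G : Finset ι) (hG : G.Nonempty) (y : ι → ℝ)
    (c : ℕ) (hc : c ≤ G.card) :
    ∃ L ⊆ G, L.card = c ∧ ∃ v, (∃ i ∈ G, v = y i) ∧ (∀ i ∈ L, y i ≤ v) ∧
      ∀ i ∈ G, i ∉ L → v ≤ y i := by
  obtain ⟨L, hL, hcard, hle⟩ := exists_lower_subset G y c hc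
  refine ⟨L, hL, hcard, ?_⟩
  rcases L.eq_empty_or_nonempty with rfl | hne
  · obtain ⟨a, ha, hmin⟩ := Finset.exists_min_image _ y hG
    exact ⟨y a, ⟨a, ha, rfl⟩, by simp, fun i hi _ => hmin i hi⟩
  · obtain ⟨a, ha, hmax⟩ := Finset.exists_max_image _ y hne
    exact ⟨y a, ⟨a, hL ha, rfl⟩, hmax, fun i hi hiL => hle a ha i hi hiL⟩

/-- A group of players is divided into parts `0, …, T` such that the parts before part `t` have
`c t` players altogether, and such that `v t` separates part `t - 1` from part `t` by the
opinion `y · t` of the players in these two parts. -/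
theorem exists_multisplit {ι : Type} [DecidableEq ι] (G : Finset ι) (y : ι → ℕ → ℝ) (c : ℕ → ℕ)
    (hc0 : c 0 = 0) (hmono : Monotone c) (hc : ∀ t, c t ≤ G.card) (T : ℕ) :
    ∃ (τ : ι → ℕ) (v : ℕ → ℝ), (∀ i, τ i ≤ T) ∧
      (∀ t ≤ T, (G.filter fun i => τ i < t).card = c t) ∧
      (∀ i ∈ G, 1 ≤ τ i → v (τ i) ≤ y i (τ i)) ∧
      (∀ i ∈ G, τ i + 1 ≤ T → y i (τ i + 1) ≤ v (τ i + 1)) ∧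
      (G.Nonempty → ∀ t, 1 ≤ t → t ≤ T → ∃ i ∈ G, v t = y i t) := by
  induction T with
  | zero =>
    refine ⟨fun _ => 0, fun _ => 0, by simp, ?_, by simp, by simp, ?_⟩
    · intro t ht
      obtain rfl : t = 0 := by omega
      simp [hc0]
    · intro _ t h1 h2
      omega
  | succ T ih =>
    obtain ⟨τ, v, hτ, hcard, hlow, hup, hmem⟩ := ih
    rcases G.eq_empty_or_nonempty with rfl | hG
    · have : ∀ t, c t = 0 := fun t => by simpa using hc t
      exact ⟨fun _ => 0, v, by simp, by simp [this], by simp, by simp, by simp⟩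
    set G' := G.filter fun i => τ i = T with hG'
    have hdisj : ∀ L ⊆ G', ((G.filter fun i => τ i < T) ∪ L).card = c T + L.card := by
      intro L hL
      rw [Finset.card_union_of_disjoint, hcard T le_rfl]
      refine Finset.disjoint_left.2 fun i hi hi' => ?_
      have h1 := (Finset.mem_filter.1 hi).2
      have h2 := (Finset.mem_filter.1 (hL hi')).2
      omega
    have hsum : c T + G'.card = G.card := by
      rw [← hdisj G' subset_rfl]
      congr 1
      ext i
      have := hτ i
      simp only [hG', Finset.mem_union, Finset.mem_filter, ← and_or_left, and_iff_left_iff_imp]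
      intro _
      omega
    obtain ⟨L, hL, hLc, w, hw, hwl, hwu⟩ : ∃ L ⊆ G', L.card = c (T + 1) - c T ∧ ∃ w,
        (∃ i ∈ G, w = y i (T + 1)) ∧ (∀ i ∈ L, y i (T + 1) ≤ w) ∧
        ∀ i ∈ G', i ∉ L → w ≤ y i (T + 1) := by
      have hle : c (T + 1) - c T ≤ G'.card := by
        have := hc (T + 1)
        omega
      -- If part `T` is empty, nobody is constrained by the new separator and any player's opinion
      -- will do.
      rcases G'.eq_empty_or_nonempty with h0 | h0
      · obtain ⟨i, hi⟩ := hG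
        refine ⟨∅, by simp, ?_, y i (T + 1), ⟨i, hi, rfl⟩, by simp, by simp [h0]⟩
        rw [h0, Finset.card_empty] at hle
        rw [Finset.card_empty]
        omega
      · obtain ⟨L, hL, hLc, w, ⟨i, hi, hwi⟩, h⟩ := exists_split G' h0 (fun i => y i (T + 1)) _ hle
        exact ⟨L, hL, hLc, w, ⟨i, (Finset.mem_filter.1 hi).1, hwi⟩, h⟩
    -- Only the last part is divided: `L` stays and the rest moves on to part `T + 1`. Earlier parts
    -- keep their separators.
    refine ⟨fun i => if i ∈ G' \ L then T + 1 else τ i, Function.update v (T + 1) w, ?_, ?_, ?_, ?_,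
      ?_⟩
    · intro i
      have := hτ i
      dsimp only
      split_ifs <;> omega
    · intro t ht
      rcases Nat.lt_or_ge T t with h | h
      · obtain rfl : t = T + 1 := by omega
        have : c T ≤ c (T + 1) := hmono (by omega)
        rw [show c (T + 1) = c T + L.card by omega, ← hdisj L hL]
        congr 1
        ext i
        have := hτ i
        have hLi := @hL i
        simp only [Finset.mem_union, Finset.mem_filter, Finset.mem_sdiff, hG'] at hLi ⊢
        by_cases hiL : i ∈ L
        · have := hLi hiL
          simp [hiL, this]
        · by_cases hiG : i ∈ G <;> by_cases hiT : τ i = T <;> simp [hiL, hiG, hiT]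
          omega
      · rw [← hcard t h]
        congr 1
        ext i
        simp only [Finset.mem_filter, and_congr_right_iff]
        intro _
        split_ifs with hi
        · have := (Finset.mem_filter.1 (Finset.mem_sdiff.1 hi).1).2
          omega
        · rfl
    · intro i hi h1
      dsimp only at h1 ⊢
      split_ifs with h
      · rw [Function.update_self]
        exact hwu i (Finset.mem_sdiff.1 h).1 (Finset.mem_sdiff.1 h).2
      · have := hτ i
        rw [Function.update_of_ne (by omega)]
        rw [if_neg h] at h1
        exact hlow i hi h1
    · intro i hi h1
      dsimp only at h1 ⊢
      split_ifs with h
      · rw [if_pos h] at h1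
        omega
      · rcases (hτ i).lt_or_eq with h2 | h2
        · rw [Function.update_of_ne (by omega)]
          exact hup i hi h2
        · rw [h2, Function.update_self]
          refine hwl i ?_
          by_contra hiL
          exact h (Finset.mem_sdiff.2 ⟨Finset.mem_filter.2 ⟨hi, h2⟩, hiL⟩)
    · intro _ t h1 h2
      rcases Nat.lt_or_ge T t with h | h
      · obtain rfl : t = T + 1 := by omega
        rw [Function.update_self]
        exact hw
      · rw [Function.update_of_ne (by omega)]
        exact hmem hG t h1 h

/-! ### Proportional cake cutting in rounds -/

/-- The players are divided into groups from left to right; a player `i` belongs to the group that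
shares the positions `l i, …, l i + g - 1` (below `n`) between the cuts `b (l i)` and
`b (l i + g)`. -/
structure Blocks (n g : ℕ) (l : Fin n → ℕ) (b : ℕ → ℝ) : Prop where
  dvd : ∀ i, g ∣ l i
  lt : ∀ i, l i < n
  card : ∀ m ≤ n, g ∣ m → (Finset.univ.filter fun i => l i < m).card = m
  zero : b 0 = 0
  top : ∀ m, n ≤ m → b m = 1

namespace Blocks

variable {n g : ℕ} {l : Fin n → ℕ} {b : ℕ → ℝ}

/-- Group starts are multiples of `g`, so the count is a difference of two prefix counts; the last
group may be short. -/
theorem card_block (h : Blocks n g l b) (hg : 1 ≤ g) {m : ℕ} (hm : m < n) (hgm : g ∣ m) :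
    (Finset.univ.filter fun i => l i = m).card = min g (n - m) := by
  have h1 := h.card m hm.le hgm
  have h2 : (Finset.univ.filter fun i => l i < m + g).card = min (m + g) n := by
    rcases le_total (m + g) n with hle | hle
    · rw [h.card _ hle ((Nat.dvd_add_right hgm).2 dvd_rfl), min_eq_left hle]
    · rw [Finset.filter_true_of_mem fun i _ => (h.lt i).trans_le hle, min_eq_right hle]
      simp
  have h3 : (Finset.univ.filter fun i => l i < m + g) =
      (Finset.univ.filter fun i => l i < m) ∪ Finset.univ.filter fun i => l i = m := by
    ext i
    simp only [Finset.mem_filter, Finset.mem_univ, true_and, Finset.mem_union]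
    refine ⟨fun hi => ?_, fun hi => by omega⟩
    by_contra hne
    have hlt : m < l i := by omega
    have := Nat.le_of_dvd (by omega) ((Nat.dvd_sub (h.dvd i) hgm))
    omega
  rw [h3, Finset.card_union_of_disjoint, h1] at h2
  · omega
  · refine Finset.disjoint_left.2 fun i hi hi' => ?_
    have h4 := (Finset.mem_filter.1 hi).2
    have h5 := (Finset.mem_filter.1 hi').2
    omega

theorem initial {n g : ℕ} (hn : 1 ≤ n) (hg : n ≤ g) :
    Blocks n g (fun _ => 0) (fun m => if m = 0 then 0 else 1) where
  dvd _ := dvd_zero g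
  lt _ := by omega
  card m hm hgm := by
    rcases Nat.eq_zero_or_pos m with rfl | h0
    · simp
    · have := Nat.le_of_dvd h0 hgm
      obtain rfl : m = n := by omega
      rw [Finset.filter_true_of_mem fun i _ => h0]
      simp
  zero := by simp
  top m hm := by rw [if_neg (by omega)]

/-- Every group is divided by `exists_multisplit`. Old cuts are kept, and each new cut is the
opinion of a player of the group concerned. A player need only agree with the two cuts next to its
own part, which is all that the next round uses. -/
theorem refine {n g z : ℕ} {l : Fin n → ℕ} {b : ℕ → ℝ} (hz : 1 ≤ z) (hg : 1 ≤ g)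
    (h : Blocks n (z * g) l b) (y : Fin n → ℕ → ℝ) :
    ∃ (l' : Fin n → ℕ) (b' : ℕ → ℝ), Blocks n g l' b' ∧ (∀ m, z * g ∣ m → b' m = b m) ∧
      (∀ m < n, g ∣ m → ¬ z * g ∣ m →
        ∃ i t, 1 ≤ t ∧ t < z ∧ m = l i + t * g ∧ b' m = y i t) ∧
      ∀ i, ∃ t < z, l' i = l i + t * g ∧ (1 ≤ t → b' (l' i) ≤ y i t) ∧
        (t + 1 < z → l' i + g < n → y i (t + 1) ≤ b' (l' i + g)) := by
  have hzg : 1 ≤ z * g := Nat.mul_pos hz hg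
  have hsplit : ∀ m, ∃ (τ : Fin n → ℕ) (v : ℕ → ℝ), (m < n → z * g ∣ m → (∀ i, τ i ≤ z - 1) ∧
      (∀ t ≤ z - 1, ((Finset.univ.filter fun i => l i = m).filter fun i => τ i < t).card =
        min (t * g) (n - m)) ∧
      (∀ i, l i = m → 1 ≤ τ i → v (τ i) ≤ y i (τ i)) ∧
      (∀ i, l i = m → τ i + 1 ≤ z - 1 → y i (τ i + 1) ≤ v (τ i + 1)) ∧
      (∀ t, 1 ≤ t → t ≤ z - 1 → ∃ i, l i = m ∧ v t = y i t)) := by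
    intro m
    by_cases hm : m < n ∧ z * g ∣ m
    · have hcard := h.card_block hzg hm.1 hm.2
      obtain ⟨τ, v, h1, h2, h3, h4, h5⟩ := exists_multisplit
        (Finset.univ.filter fun i => l i = m) y (fun t => min (t * g) (min (z * g) (n - m)))
        (by simp)
        (fun s t hst => min_le_min_right _ (Nat.mul_le_mul_right g hst))
        (fun t => by rw [hcard]; exact min_le_right _ _) (z - 1)
      refine ⟨τ, v, fun _ _ => ⟨h1, ?_, ?_, ?_, ?_⟩⟩
      · intro t ht
        rw [h2 t ht, ← min_assoc, min_eq_left (Nat.mul_le_mul_right g (by omega : t ≤ z))]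
      · exact fun i hi => h3 i (by simpa using hi)
      · exact fun i hi => h4 i (by simpa using hi)
      · intro t ht1 ht2
        have hne : (Finset.univ.filter fun i => l i = m).Nonempty := by
          rw [← Finset.card_pos, hcard]
          have := hm.1
          omega
        obtain ⟨i, hi, hv⟩ := h5 hne t ht1 ht2
        exact ⟨i, by simpa using hi, hv⟩
    · exact ⟨fun _ => 0, fun _ => 0, fun h1 h2 => absurd ⟨h1, h2⟩ hm⟩
  choose τ v hτv using hsplit
  have H := fun i => hτv (l i) (h.lt i) (h.dvd i)
  -- A new position is split into the start of its old group and the number of the part inside that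
  -- group.
  set b' : ℕ → ℝ := fun m => if n ≤ m then 1 else if z * g ∣ m then b m else
    v (m - m % (z * g)) (m % (z * g) / g) with hb'
  have hb'dvd : ∀ m, z * g ∣ m → b' m = b m := by
    intro m hm
    simp only [hb', if_pos hm]
    split_ifs with hnm
    · exact (h.top m hnm).symm
    · rfl
  have hb'add : ∀ m t, z * g ∣ m → 1 ≤ t → t < z → m + t * g < n → b' (m + t * g) = v m t := by
    intro m t hm h1 h2 hlt
    have e0 : t * g < z * g := Nat.mul_lt_mul_of_pos_right h2 hg
    have e1 : (m + t * g) % (z * g) = t * g := by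
      obtain ⟨c, rfl⟩ := hm
      rw [Nat.mul_add_mod, Nat.mod_eq_of_lt e0]
    have e2 : ¬ z * g ∣ m + t * g := by
      rw [Nat.dvd_iff_mod_eq_zero, e1]
      exact (Nat.mul_pos h1 hg).ne'
    simp only [hb', if_neg (not_le.2 hlt), if_neg e2, e1, Nat.add_sub_cancel,
      Nat.mul_div_cancel t hg]
  -- If the part of `i` began at `n` or later, the earlier parts would already hold the whole group,
  -- including `i`.
  have hlt : ∀ i, l i + τ (l i) i * g < n := by
    intro i
    obtain ⟨h1, h2, -⟩ := H i
    by_contra hge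
    have hln := h.lt i
    have hcard := h.card_block hzg hln (h.dvd i)
    have h3 := h2 (τ (l i) i) (h1 i)
    have h4 : τ (l i) i * g ≤ z * g := Nat.mul_le_mul_right g ((h1 i).trans (by omega))
    have h5 : ((Finset.univ.filter fun j => l j = l i).filter fun j => τ (l i) j < τ (l i) i) =
        Finset.univ.filter fun j => l j = l i :=
      Finset.eq_of_subset_of_card_le (Finset.filter_subset _ _) (by omega)
    have h6 : i ∈ (Finset.univ.filter fun j => l j = l i).filter
        fun j => τ (l i) j < τ (l i) i := by
      rw [h5]
      simp
    exact lt_irrefl _ (Finset.mem_filter.1 h6).2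
  have hdecomp : ∀ m, g ∣ m → ∃ M t, z * g ∣ M ∧ t < z ∧ m = M + t * g := by
    rintro _ ⟨d, rfl⟩
    refine ⟨z * g * (d / z), d % z, Dvd.intro _ rfl, Nat.mod_lt _ hz, ?_⟩
    conv_lhs => rw [← Nat.div_add_mod d z]
    ring
  have hgl : ∀ i, g ∣ l i := fun i => (Dvd.intro_left z rfl).trans (h.dvd i)
  refine ⟨fun i => l i + τ (l i) i * g, b', ⟨?_, hlt, ?_, ?_, ?_⟩, hb'dvd, ?_, ?_⟩
  · exact fun i => (Nat.dvd_add_right (hgl i)).2 (Dvd.intro_left _ rfl)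
  · intro m hm hgm
    obtain ⟨M, t, hM, ht, rfl⟩ : ∃ M t, z * g ∣ M ∧ t < z ∧ m = M + t * g := hdecomp m hgm
    rcases Nat.eq_zero_or_pos (t * g) with h0 | h0
    · rw [h0, add_zero] at hm ⊢
      refine Eq.trans ?_ (h.card _ hm hM)
      congr 1
      ext i
      simp only [Finset.mem_filter, Finset.mem_univ, true_and]
      refine ⟨fun hi => by omega, fun hi => ?_⟩
      have h1 := ((H i).1 i)
      have h2 : τ (l i) i * g < z * g := Nat.mul_lt_mul_of_pos_right (by omega) hg
      have h3 : z * g ∣ M - l i := Nat.dvd_sub hM (h.dvd i)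
      have h4 := Nat.le_of_dvd (by omega) h3
      omega
    · have hcn : M < n := by omega
      obtain ⟨-, h2, -⟩ := hτv M hcn hM
      have h3 := h2 t (by omega)
      rw [min_eq_left (by omega)] at h3
      have hunion : (Finset.univ.filter fun i => l i + τ (l i) i * g < M + t * g) =
          (Finset.univ.filter fun i => l i < M) ∪
            (Finset.univ.filter fun i => l i = M).filter fun i => τ M i < t := by
        ext i
        simp only [Finset.mem_filter, Finset.mem_univ, true_and, Finset.mem_union]
        have h1 := (H i).1 i
        have h4 : τ (l i) i * g < z * g := Nat.mul_lt_mul_of_pos_right (by omega) hg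
        have h5 : t * g < z * g := Nat.mul_lt_mul_of_pos_right ht hg
        rcases lt_trichotomy (l i) M with hi | hi | hi
        · have h6 : z * g ∣ M - l i := Nat.dvd_sub hM (h.dvd i)
          have h7 := Nat.le_of_dvd (by omega) h6
          simp only [hi, true_or, iff_true]
          omega
        · simp only [hi, lt_irrefl, true_and, false_or, Nat.add_lt_add_iff_left]
          exact Nat.mul_lt_mul_right hg
        · have h6 : z * g ∣ l i - M := Nat.dvd_sub (h.dvd i) hM
          have h7 := Nat.le_of_dvd (by omega) h6
          constructor <;> intro <;> omega
      rw [hunion, Finset.card_union_of_disjoint, h.card M hcn.le hM, h3]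
      refine Finset.disjoint_left.2 fun i hi hi' => ?_
      have h4 := (Finset.mem_filter.1 hi).2
      have h5 := (Finset.mem_filter.1 (Finset.mem_filter.1 hi').1).2
      omega
  · rw [hb'dvd 0 (dvd_zero _), h.zero]
  · intro m hm
    simp only [hb', if_pos hm]
  · intro m hm hgm hzm
    obtain ⟨M, t, hM, ht, rfl⟩ : ∃ M t, z * g ∣ M ∧ t < z ∧ m = M + t * g := hdecomp m hgm
    have ht1 : 1 ≤ t := by
      by_contra h0
      obtain rfl : t = 0 := by omega
      exact hzm (by simpa using hM)
    obtain ⟨-, -, -, -, h5⟩ := hτv M (by omega) hM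
    obtain ⟨i, hi, hv⟩ := h5 t ht1 (by omega)
    exact ⟨i, t, ht1, ht, by rw [hi], by rw [hb'add _ t hM ht1 ht hm, hv]⟩
  · intro i
    obtain ⟨h1, -, h3, h4, -⟩ := H i
    have h1 := h1 i
    refine ⟨τ (l i) i, by omega, rfl, fun ht => ?_, fun ht hn => ?_⟩
    · rw [hb'add _ _ (h.dvd i) ht (by omega) (hlt i)]
      exact h3 i rfl ht
    · have e : l i + τ (l i) i * g + g = l i + (τ (l i) i + 1) * g := by ring
      rw [e] at hn ⊢
      rw [hb'add _ _ (h.dvd i) (by omega) ht hn]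
      exact h4 i rfl (by omega)

end Blocks

/-- A batch of queries indexed by a finite type. -/
theorem exists_batch {ι Q : Type} [Fintype ι] (f : ι → Q) :
    ∃ (qs : List Q) (read : List ℝ → ι → ℝ), qs.length = Fintype.card ι ∧
      (∀ q, q ∈ qs ↔ ∃ i, f i = q) ∧ ∀ (o : Q → ℝ) (i : ι), read (qs.map o) i = o (f i) := by
  let e := Fintype.equivFin ι
  refine ⟨List.ofFn fun j => f (e.symm j), fun as i => as.getD (e i) 0, by simp, ?_, ?_⟩
  · intro q
    rw [List.mem_ofFn]
    exact ⟨fun ⟨j, hj⟩ => ⟨e.symm j, hj⟩, fun ⟨i, hi⟩ => ⟨e i, by simpa using hi⟩⟩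
  · intro o i
    have : (e i : ℕ) < ((List.ofFn fun j => f (e.symm j)).map o).length := by simp
    dsimp only
    rw [List.getD_eq_getElem _ _ this]
    simp

/-- The players agree with the division into groups, and its cuts have been made. -/
structure Consistent {n : ℕ} (V : Fin n → Valuation) (cuts : Set ℝ) (g : ℕ) (l : Fin n → ℕ)
    (b : ℕ → ℝ) : Prop where
  subset : cuts ⊆ Set.Icc 0 1
  mem : ∀ m, g ∣ m → b m = 0 ∨ b m = 1 ∨ b m ∈ cuts
  left : ∀ i, (V i).value (Set.Icc 0 (b (l i))) ≤ (l i : ℝ) / n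
  right : ∀ i, ((min (l i + g) n : ℕ) : ℝ) / n ≤ (V i).value (Set.Icc 0 (b (l i + g)))

theorem Consistent.mem_Icc {n : ℕ} {V : Fin n → Valuation} {cuts : Set ℝ} {g : ℕ}
    {l : Fin n → ℕ} {b : ℕ → ℝ} (h : Consistent V cuts g l b) {m : ℕ} (hm : g ∣ m) :
    b m ∈ Set.Icc (0 : ℝ) 1 := by
  rcases h.mem m hm with h1 | h1 | h1
  · simp [h1]
  · simp [h1]
  · exact h.subset h1

/-- In groups of one position, the two bounds of `Consistent` differ by exactly `1 / n`, which is
the share required. -/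
theorem Blocks.exists_allocation {n : ℕ} {l : Fin n → ℕ} {b : ℕ → ℝ} (hn : 1 ≤ n)
    (h : Blocks n 1 l b) :
    ∃ A : Allocation n, ∀ V cuts, Consistent V cuts 1 l b →
      (∀ j, A.bdry j = 0 ∨ A.bdry j = 1 ∨ A.bdry j ∈ cuts) ∧ A.Proportional V := by
  have hinj : Function.Injective fun i => (⟨l i, h.lt i⟩ : Fin n) := by
    intro i j hij
    have hij : l i = l j := congrArg Fin.val hij
    have hc := h.card_block le_rfl (h.lt j) (one_dvd _)
    have hj := h.lt j
    exact Finset.card_le_one.1 (by omega : (Finset.univ.filter fun i => l i = l j).card ≤ 1) i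
      (by simpa using hij) j (by simp)
  let e : Fin n ≃ Fin n := Equiv.ofBijective _ (Finite.injective_iff_bijective.1 hinj)
  have he : ∀ i, ((e i : Fin n) : ℕ) = l i := fun i => rfl
  by_cases hm : Monotone fun j : Fin (n + 1) => b j
  · refine ⟨⟨e.symm, fun j => b j, hm, h.zero, h.top _ (by simp)⟩, fun V cuts hV => ⟨?_, ?_⟩⟩
    · exact fun j => hV.mem j (one_dvd _)
    · intro i
      unfold Allocation.piece
      rw [Allocation.value_slice]
      simp only [Equiv.symm_symm, Fin.val_succ, Fin.val_castSucc, he]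
      have h1 := hV.left i
      have h2 := hV.right i
      rw [min_eq_left (by have := h.lt i; omega)] at h2
      push_cast at h2
      rw [add_div] at h2
      linarith
  -- A dummy output: cuts in the wrong order cannot be consistent with any players, because the
  -- player between them would value a smaller piece `[0, y]` more.
  · refine ⟨⟨1, fun j => if j = 0 then 0 else 1, ?_, by simp, ?_⟩, fun V cuts hV => (hm ?_).elim⟩
    · intro i j hij
      dsimp only
      split_ifs with h1 h2
      · exact le_rfl
      · exact zero_le_one
      · subst_vars
        exact absurd (le_antisymm hij (Fin.zero_le i)) h1
      · exact le_rfl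
    · rw [if_neg]
      intro h0
      have := congrArg Fin.val h0
      simp only [Fin.val_last, Fin.val_zero] at this
      omega
    · refine Fin.monotone_iff_le_succ.2 fun j => ?_
      by_contra hlt
      have hlt := (not_le.1 hlt).le
      have hj : l (e.symm j) = j := by rw [← he, Equiv.apply_symm_apply]
      have h1 := hV.left (e.symm j)
      have h2 := hV.right (e.symm j)
      rw [hj] at h1 h2
      simp only [Fin.val_succ, Fin.val_castSucc] at hlt
      have h3 := (V (e.symm j)).value_mono (hV.mem_Icc (one_dvd _)).1 hlt
        (hV.mem_Icc (one_dvd _)).2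
      have h4 : ((min ((j : ℕ) + 1) n : ℕ) : ℝ) / n ≤ (j : ℕ) / n := h2.trans (h3.trans h1)
      rw [div_le_div_iff_of_pos_right (by exact_mod_cast hn), Nat.cast_le] at h4
      have := j.2
      omega

/-- One round divides the size of the groups by `z`. Targets are values of pieces `[0, y]`, not
shares of the group's piece, so they depend only on the positions of the group and no eval query is
needed. -/
theorem Blocks.exists_protocol {n z : ℕ} (hn : 1 ≤ n) (hz : 1 ≤ z) (J : ℕ) :
    ∀ (l : Fin n → ℕ) (b : ℕ → ℝ), Blocks n (z ^ J) l b →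
      ∃ P : RWProtocol n, ∀ V cuts, Consistent V cuts (z ^ J) l b →
        RWProtocol.Legal V cuts P ∧ (P.output (rwOracle V)).Proportional V ∧
        P.rounds (rwOracle V) ≤ J ∧ P.queries (rwOracle V) ≤ J * (n * (z - 1)) := by
  have hn' : (0 : ℝ) < n := by exact_mod_cast hn
  induction J with
  | zero =>
    intro l b h
    rw [pow_zero] at h
    obtain ⟨A, hA⟩ := h.exists_allocation hn
    refine ⟨.done A, fun V cuts hV => ?_⟩
    rw [pow_zero] at hV
    have := hA V cuts hV
    exact ⟨this.1, this.2, le_rfl, by simp [RoundAlg.queries]⟩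
  | succ J ih =>
    intro l b h
    rw [pow_succ'] at h
    set g := z ^ J with hgdef
    have hg : 1 ≤ g := Nat.one_le_pow _ _ hz
    choose P hP using ih
    choose l' b' hB hold hnew hpl using h.refine hz hg
    -- The cap at `n` keeps the queries of a short last group admissible.
    let α : Fin n → ℕ → ℝ := fun i t => ((min (l i + t * g) n : ℕ) : ℝ) / n
    have hα : ∀ i t, α i t ∈ Set.Icc (0 : ℝ) 1 := by
      intro i t
      refine ⟨by positivity, ?_⟩
      rw [div_le_one hn']
      exact_mod_cast min_le_right _ _
    obtain ⟨qs, read, hlen, hqs, hread⟩ := exists_batch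
      fun p : Fin n × Fin (z - 1) => RWQuery.cut p.1 (α p.1 (p.2 + 1))
    -- Cut `t` has index `t - 1`; only `1 ≤ t < z` matters, and the value `0` elsewhere is a filler.
    let y : List ℝ → Fin n → ℕ → ℝ := fun as i t =>
      if ht : t - 1 < z - 1 then read as (i, ⟨t - 1, ht⟩) else 0
    refine ⟨.round qs fun as => P (l' (y as)) (b' (y as)) (hB (y as)), fun V cuts hV => ?_⟩
    rw [pow_succ', ← hgdef] at hV
    set as := qs.map (rwOracle V) with has
    have hy : ∀ i t, 1 ≤ t → t < z → y as i t = (V i).cutPoint (α i t) := by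
      intro i t h1 h2
      have ht : t - 1 < z - 1 := by omega
      simp only [y, dif_pos ht, has, hread, rwOracle]
      congr 2
      omega
    have hyv : ∀ i t, (V i).value (Set.Icc 0 ((V i).cutPoint (α i t))) = α i t := fun i t =>
      ((V i).isLeast_cutPoint (hα i t)).1.2
    have hyI : ∀ i t, (V i).cutPoint (α i t) ∈ Set.Icc (0 : ℝ) 1 := fun i t =>
      ((V i).isLeast_cutPoint (hα i t)).1.1
    have hC : Consistent V
        (cuts ∪ {y | ∃ i α, RWQuery.cut i α ∈ qs ∧ y = (V i).cutPoint α}) g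
        (l' (y as)) (b' (y as)) := by
      have hsub : (cuts ∪ {y | ∃ i α, RWQuery.cut i α ∈ qs ∧ y = (V i).cutPoint α}) ⊆
          Set.Icc 0 1 := by
        rintro x (hx | ⟨i, β, hi, rfl⟩)
        · exact hV.subset hx
        · obtain ⟨p, hp⟩ := (hqs _).1 hi
          simp only [RWQuery.cut.injEq] at hp
          obtain ⟨rfl, rfl⟩ := hp
          exact hyI _ _
      have hmem : ∀ m, g ∣ m → b' (y as) m = 0 ∨ b' (y as) m = 1 ∨ b' (y as) m ∈
          (cuts ∪ {y | ∃ i α, RWQuery.cut i α ∈ qs ∧ y = (V i).cutPoint α}) := by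
        intro m hm
        by_cases hmn : n ≤ m
        · exact Or.inr (Or.inl ((hB (y as)).top m hmn))
        by_cases hzm : z * g ∣ m
        · rw [hold (y as) m hzm]
          exact (hV.mem m hzm).imp_right fun h => h.imp_right Or.inl
        · obtain ⟨i, t, h1, h2, -, h3⟩ := hnew (y as) m (by omega) hm hzm
          refine Or.inr (Or.inr (Or.inr ⟨i, α i t, (hqs _).2 ⟨(i, ⟨t - 1, by omega⟩), ?_⟩, ?_⟩))
          · simp only
            congr 2
            omega
          · rw [h3, hy i t h1 h2]
      have hI : ∀ m, g ∣ m → b' (y as) m ∈ Set.Icc (0 : ℝ) 1 := by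
        intro m hm
        rcases hmem m hm with h1 | h1 | h1
        · simp [h1]
        · simp [h1]
        · exact hsub h1
      refine ⟨hsub, hmem, fun i => ?_, fun i => ?_⟩
      · obtain ⟨t, ht, hl, h1, -⟩ := hpl (y as) i
        rcases Nat.eq_zero_or_pos t with rfl | h0
        · rw [zero_mul, add_zero] at hl
          rw [hl, hold (y as) _ (h.dvd i)]
          exact hV.left i
        · have h2 := h1 h0
          rw [hy i t h0 ht] at h2
          refine ((V i).value_mono (hI _ ((hB (y as)).dvd i)).1 h2 (hyI i t).2).trans ?_
          rw [hyv]
          simp only [α, ← hl, min_eq_left ((hB (y as)).lt i).le, le_refl]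
      · obtain ⟨t, ht, hl, -, h1⟩ := hpl (y as) i
        have hdvd : g ∣ l' (y as) i + g := (Nat.dvd_add_left dvd_rfl).2 ((hB (y as)).dvd i)
        by_cases hln : n ≤ l' (y as) i + g
        · have hone : (V i).value (Set.Icc 0 1) = 1 := (V i).total
          rw [(hB (y as)).top _ hln, hone, min_eq_right hln, div_self hn'.ne']
        rcases Nat.lt_or_ge (t + 1) z with h0 | h0
        · have h2 := h1 h0 (by omega)
          rw [hy i (t + 1) (by omega) h0] at h2
          refine le_trans ?_ ((V i).value_mono (hyI i (t + 1)).1 h2 (hI _ hdvd).2)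
          rw [hyv]
          simp only [α]
          rw [hl, add_assoc, add_one_mul]
        · have e : l' (y as) i + g = l i + z * g := by
            obtain rfl : z = t + 1 := by omega
            rw [hl]
            ring
          rw [e, hold (y as) _ ((Nat.dvd_add_left dvd_rfl).2 (h.dvd i))]
          exact hV.right i
    obtain ⟨h1, h2, h3, h4⟩ := hP _ _ (hB (y as)) V _ hC
    refine ⟨⟨fun q hq => ?_, h1⟩, h2, ?_, ?_⟩
    · obtain ⟨p, rfl⟩ := (hqs q).1 hq
      exact hα _ _
    · simp only [RoundAlg.rounds]
      rw [← has]
      omega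
    · simp only [RoundAlg.queries]
      rw [← has, hlen, add_mul, one_mul, Fintype.card_prod, Fintype.card_fin, Fintype.card_fin]
      omega

/-- Proportional cake cutting with contiguous pieces in `J` rounds. -/
theorem exists_protocol {n z J : ℕ} (hn : 1 ≤ n) (hz : 1 ≤ z) (hJ : n ≤ z ^ J) :
    ∃ P : RWProtocol n, P.Solves J (J * (n * (z - 1))) := by
  obtain ⟨P, hP⟩ := Blocks.exists_protocol hn hz J _ _ (Blocks.initial hn hJ)
  refine ⟨P, fun V => hP V ∅ ⟨by simp, ?_, ?_, ?_⟩⟩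
  · intro m _
    split_ifs <;> simp
  · intro i
    rw [if_pos rfl, Valuation.value_Icc_zero]
    simp
  · intro i
    have hone : (V i).value (Set.Icc 0 1) = 1 := (V i).total
    have hz0 : z ≠ 0 := by omega
    rw [zero_add, min_eq_right hJ, if_neg (pow_ne_zero _ hz0), hone, div_self]
    exact_mod_cast (by omega : n ≠ 0)

theorem RWProtocol.Solves.mono {n : ℕ} {P : RWProtocol n} {k k' q q' : ℕ} (h : P.Solves k q)
    (hk : k ≤ k') (hq : q ≤ q') : P.Solves k' q' := fun V =>
  ⟨(h V).1, (h V).2.1, (h V).2.2.1.trans hk, (h V).2.2.2.trans hq⟩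

/-- Proportional cake cutting is as easy as sorting with rank queries. -/
theorem SortAlg.Solves.exists_protocol {n : ℕ} {S : SortAlg n} {k q : ℕ} (hS : S.Solves k q)
    (hn : 1 ≤ n) (hk : 1 ≤ k) : ∃ P : RWProtocol n, P.Solves k (40 * q) := by
  -- A single player takes the whole cake without a query; for `n ≥ 2` the logarithm is positive.
  rcases hn.eq_or_lt with rfl | hn2
  · obtain ⟨P, hP⟩ := CakeSort.exists_protocol (n := 1) (z := 1) (J := 0) le_rfl le_rfl le_rfl
    exact ⟨P, hP.mono (Nat.zero_le _) (by simp)⟩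
  have hlog := hS.mul_log_le hn
  have hlog1 : 1 ≤ Nat.log 2 n := Nat.log_pos (by norm_num) hn2
  have hex : ∃ z, n ≤ z ^ k := ⟨n, Nat.le_self_pow (by omega) n⟩
  obtain ⟨z, hz, hmin⟩ : ∃ z, n ≤ z ^ k ∧ ∀ v < z, v ^ k < n :=
    ⟨Nat.find hex, Nat.find_spec hex, fun v hv => not_le.1 (Nat.find_min hex hv)⟩
  have hz2 : 2 ≤ z := by
    by_contra h
    have : z ^ k ≤ 1 ^ k := Nat.pow_le_pow_left (by omega) k
    rw [one_pow] at this
    omega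
  have hv := hmin (z - 1) (by omega)
  -- For `z = 2` there may be far more rounds than needed, so only `Nat.clog 2 n` of them are used.
  -- Otherwise `(z - 1) ^ k < n`: this is the hypothesis of `mul_mul_le` if `z - 1 ≥ 6`, and it
  -- bounds `k` by `Nat.log 2 n` if `z - 1 ≤ 5`. The three cases cost at most `8 * q`, `10 * q` and
  -- `20 * q`.
  rcases hz2.eq_or_lt with rfl | hz3
  · have hc : Nat.clog 2 n ≤ k := Nat.clog_le_of_le_pow hz
    have hc2 : Nat.clog 2 n ≤ Nat.log 2 n + 1 :=
      Nat.clog_le_of_le_pow (Nat.lt_pow_succ_log_self (by norm_num) n).le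
    obtain ⟨P, hP⟩ := CakeSort.exists_protocol hn (by norm_num : 1 ≤ 2)
      (Nat.le_pow_clog (by norm_num) n)
    refine ⟨P, hP.mono hc ?_⟩
    have : Nat.clog 2 n * n ≤ (2 * Nat.log 2 n) * n := Nat.mul_le_mul_right n (by omega)
    norm_num
    nlinarith
  · obtain ⟨P, hP⟩ := CakeSort.exists_protocol hn (by omega : 1 ≤ z) hz
    refine ⟨P, hP.mono le_rfl ?_⟩
    rcases Nat.lt_or_ge (z - 1) 6 with h6 | h6
    · have hkl : k ≤ Nat.log 2 n := Nat.le_log_of_pow_le (by norm_num)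
        ((Nat.pow_le_pow_left (by omega : 2 ≤ z - 1) k).trans hv.le)
      calc k * (n * (z - 1)) ≤ Nat.log 2 n * (n * 5) :=
            Nat.mul_le_mul hkl (Nat.mul_le_mul_left n (by omega))
        _ = 5 * (n * Nat.log 2 n) := by ring
        _ ≤ 40 * q := by omega
    · have := hS.mul_mul_le hk h6 hv.le
      rw [← mul_assoc]
      omega

/-! ### Valuations that force the order of the players -/

/-- The point of `[0,1]` that is closest to `x`. -/
def clamp (x : ℝ) : ℝ := max 0 (min x 1)

theorem clamp_of_le {x : ℝ} (h : x ≤ 0) : clamp x = 0 :=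
  max_eq_left ((min_le_left _ _).trans h)

theorem clamp_of_ge {x : ℝ} (h : 1 ≤ x) : clamp x = 1 := by
  rw [clamp, min_eq_right h, max_eq_right zero_le_one]

theorem clamp_of_mem {x : ℝ} (h0 : 0 ≤ x) (h1 : x ≤ 1) : clamp x = x := by
  rw [clamp, min_eq_left h1, max_eq_right h0]

theorem clamp_lt {x w : ℝ} (hw : 0 < w) (h : x < w) : clamp x < w :=
  max_lt hw ((min_le_left _ _).trans_lt h)

/-- The third of zone `j` of the cake that a player of rank `s` likes. -/
def third (s j : ℕ) : ℝ := orderingCode (compare s (j + 1)) + 1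

theorem third_nonneg (s j : ℕ) : 0 ≤ third s j := by
  unfold third
  cases compare s (j + 1) <;> simp [orderingCode]

theorem third_le (s j : ℕ) : third s j ≤ 2 := by
  unfold third
  cases compare s (j + 1) <;> norm_num [orderingCode]

/-- The left end of the part of zone `j` that a player of rank `s` likes. -/
def likedLeft (n s j : ℕ) : ℝ := (j + third s j / 3) / (n + 1)

theorem likedLeft_nonneg (n s j : ℕ) : 0 ≤ likedLeft n s j := by
  have := third_nonneg s j
  unfold likedLeft
  positivity

/-- The density of a player of rank `s`. -/
def hardDensity (n s : ℕ) (x : ℝ) : ℝ :=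
  ∑ j ∈ Finset.range (n + 1),
    (Set.Ioc (likedLeft n s j) (likedLeft n s j + 1 / (3 * (n + 1)))).indicator (fun _ => 3) x

/-- The value of `[0,y]` for a player of rank `s`. -/
def hardValue (n s : ℕ) (y : ℝ) : ℝ :=
  (∑ j ∈ Finset.range (n + 1), clamp (3 * ((n + 1) * y - j) - third s j)) / (n + 1)

theorem integrableOn_indicator_Ioc (l r y : ℝ) :
    IntegrableOn ((Set.Ioc l r).indicator fun _ => (3 : ℝ)) (Set.Icc 0 y) :=
  (integrableOn_const (by simp)).indicator measurableSet_Ioc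

theorem integral_indicator_Ioc {l w y : ℝ} (hl : 0 ≤ l) (hw : 0 < w) :
    ∫ x in Set.Icc 0 y, (Set.Ioc l (l + w)).indicator (fun _ => (3 : ℝ)) x =
      3 * w * clamp ((y - l) / w) := by
  rw [setIntegral_indicator measurableSet_Ioc]
  have h : Set.Icc 0 y ∩ Set.Ioc l (l + w) = Set.Ioc l (min y (l + w)) := by
    ext x
    simp only [Set.mem_inter_iff, Set.mem_Icc, Set.mem_Ioc, le_min_iff]
    constructor
    · rintro ⟨⟨_, h1⟩, h2, h3⟩
      exact ⟨h2, h1, h3⟩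
    · rintro ⟨h2, h1, h3⟩
      exact ⟨⟨hl.trans h2.le, h1⟩, h2, h3⟩
  rw [h, setIntegral_const, Measure.real, Real.volume_Ioc, ENNReal.toReal_ofReal']
  have e : max (min y (l + w) - l) 0 = w * clamp ((y - l) / w) := by
    rw [clamp, mul_max_of_nonneg _ _ hw.le, mul_min_of_nonneg _ _ hw.le, mul_div_cancel₀ _ hw.ne',
      max_comm, mul_zero, mul_one, ← min_sub_sub_right]
    congr 2
    ring
  rw [e, smul_eq_mul]
  ring

theorem integral_hardDensity (n s : ℕ) (y : ℝ) :
    ∫ x in Set.Icc 0 y, hardDensity n s x = hardValue n s y := by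
  unfold hardDensity hardValue
  rw [integral_finsetSum _ fun j _ => integrableOn_indicator_Ioc _ _ _, Finset.sum_div]
  refine Finset.sum_congr rfl fun j _ => ?_
  rw [integral_indicator_Ioc (likedLeft_nonneg n s j) (by positivity)]
  have e : (y - likedLeft n s j) / (1 / (3 * (n + 1))) =
      3 * ((n + 1) * y - j) - third s j := by
    unfold likedLeft
    field_simp
    ring
  rw [e]
  field_simp

/-- In zone `j`, only this zone matters. -/
theorem hardValue_eq {n s j : ℕ} {y : ℝ} (hj : j ≤ n) (h1 : (j : ℝ) ≤ (n + 1) * y)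
    (h2 : (n + 1) * y ≤ j + 1) :
    hardValue n s y = (j + clamp (3 * ((n + 1) * y - j) - third s j)) / (n + 1) := by
  unfold hardValue
  congr 1
  rw [← Finset.sum_range_add_sum_Ico _ (by omega : j + 1 ≤ n + 1), Finset.sum_range_succ]
  have e1 : ∑ i ∈ Finset.range j, clamp (3 * ((n + 1) * y - i) - third s i) = j := by
    rw [Finset.sum_congr rfl fun i hi => clamp_of_ge ?_]
    · simp
    · have := third_le s i
      have : (i : ℝ) + 1 ≤ j := by exact_mod_cast Finset.mem_range.1 hi
      linarith
  have e2 : ∑ i ∈ Finset.Ico (j + 1) (n + 1), clamp (3 * ((n + 1) * y - i) - third s i) = 0 := by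
    refine Finset.sum_eq_zero fun i hi => clamp_of_le ?_
    have := third_nonneg s i
    have : (j : ℝ) + 1 ≤ i := by exact_mod_cast (Finset.mem_Ico.1 hi).1
    linarith
  rw [e1, e2, add_zero]

/-- Players of all ranks agree at the ends of the zones, where length and value coincide. -/
theorem hardValue_div {n s t : ℕ} (ht : t ≤ n + 1) :
    hardValue n s (t / (n + 1)) = t / (n + 1) := by
  have hN : (0 : ℝ) < n + 1 := by positivity
  have e : ((n : ℝ) + 1) * (t / (n + 1)) = t := by field_simp
  rcases Nat.eq_zero_or_pos t with rfl | h0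
  · rw [hardValue_eq (Nat.zero_le n) (by simp) (by simp), clamp_of_le]
    · simp
    · have := third_nonneg s 0
      simp only [CharP.cast_eq_zero, zero_div, mul_zero, sub_zero]
      linarith
  · obtain ⟨j, rfl⟩ : ∃ j, t = j + 1 := ⟨t - 1, by omega⟩
    rw [hardValue_eq (by omega : j ≤ n) (by rw [e]; push_cast; linarith) (by rw [e]; push_cast; rfl),
      clamp_of_ge]
    · push_cast; rfl
    · have := third_le s j
      rw [e]
      push_cast
      linarith

/-- The valuation of a player of rank `s`: the cake is divided into `n + 1` zones of value
`1 / (n + 1)`. -/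
def hardValuation (n s : ℕ) : Valuation where
  density := hardDensity n s
  nonneg _ _ := Finset.sum_nonneg fun _ _ => Set.indicator_nonneg (fun _ _ => by norm_num) _
  integrable := integrable_finsetSum _ fun _ _ => integrableOn_indicator_Ioc _ _ _
  total := by
    rw [integral_hardDensity]
    have h := hardValue_div (n := n) (s := s) (le_refl (n + 1))
    push_cast at h
    rwa [div_self (by positivity)] at h

theorem hardValuation_value (n s : ℕ) (y : ℝ) :
    (hardValuation n s).value (Set.Icc 0 y) = hardValue n s y :=
  integral_hardDensity n s y

theorem hardValue_mono {n s : ℕ} {y z : ℝ} (h : y ≤ z) : hardValue n s y ≤ hardValue n s z := by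
  unfold hardValue
  have : ∀ j : ℕ, clamp (3 * ((n + 1) * y - j) - third s j) ≤
      clamp (3 * ((n + 1) * z - j) - third s j) := fun j => by
    refine max_le_max_left _ (min_le_min_right _ ?_)
    have : ((n : ℝ) + 1) * y ≤ (n + 1) * z := mul_le_mul_of_nonneg_left h (by positivity)
    linarith
  exact div_le_div_of_nonneg_right (Finset.sum_le_sum fun j _ => this j) (by positivity)

/-- Density 3 on the liked third makes the cut advance through it at one third of the rate of the
value. The zone is open on the left and closed on the right because the leftmost cut for the full
value of a zone is the end of its liked third. -/
theorem hardValuation_cutPoint {n s j : ℕ} {α : ℝ} (hj : j ≤ n) (h1 : (j : ℝ) < (n + 1) * α)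
    (h2 : (n + 1) * α ≤ j + 1) :
    (hardValuation n s).cutPoint α =
      (j + (third s j + ((n + 1) * α - j)) / 3) / (n + 1) := by
  have hN : (0 : ℝ) < n + 1 := by positivity
  have ht0 := third_nonneg s j
  have ht2 := third_le s j
  have hjn : (j : ℝ) ≤ n := by exact_mod_cast hj
  have hj0 : (0 : ℝ) ≤ j := by positivity
  set y := (j + (third s j + ((n + 1) * α - j)) / 3) / ((n : ℝ) + 1) with hy
  have e : ((n : ℝ) + 1) * y = j + (third s j + ((n + 1) * α - j)) / 3 := by
    rw [hy]; field_simp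
  refine Valuation.cutPoint_eq _ ⟨?_, ?_⟩ ?_ ?_
  · rw [hy]
    exact div_nonneg (by linarith) hN.le
  · rw [hy, div_le_one hN]
    linarith
  · rw [hardValuation_value, hardValue_eq hj (by linarith) (by linarith), e, clamp_of_mem]
    · field_simp
      ring
    · linarith
    · linarith
  · intro z hz hzy
    rw [hardValuation_value]
    refine ne_of_lt ?_
    have hz' : ((n : ℝ) + 1) * z < (n + 1) * y := mul_lt_mul_of_pos_left hzy hN
    rw [← mul_div_cancel_left₀ α hN.ne']
    rcases le_total (j : ℝ) ((n + 1) * z) with h | h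
    · rw [hardValue_eq hj h (by linarith), div_lt_div_iff_of_pos_right hN]
      have := clamp_lt (sub_pos.2 h1)
        (by linarith : 3 * ((n + 1) * z - j) - third s j < (n + 1) * α - j)
      linarith
    · refine (hardValue_mono ((le_div_iff₀' hN).2 h)).trans_lt ?_
      rw [hardValue_div (by omega), div_lt_div_iff_of_pos_right hN]
      exact h1

theorem hardValuation_cutPoint_zero (n s : ℕ) : (hardValuation n s).cutPoint 0 = 0 :=
  Valuation.cutPoint_eq _ (by simp) (Valuation.value_Icc_zero _)
    fun z h1 h2 => absurd h1 (not_le.2 h2)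

/-- Zone `t` adds nothing before its liked third and nothing after it. This lemma and the next
locate a boundary relative to that third. -/
theorem lt_of_lt_hardValue {n s t : ℕ} {y : ℝ} (ht : t ≤ n)
    (h : t / ((n : ℝ) + 1) < hardValue n s y) : t + third s t / 3 < (n + 1) * y := by
  by_contra hle
  have hN : (0 : ℝ) < n + 1 := by positivity
  have h0 := third_nonneg s t
  have h2 := third_le s t
  refine absurd h (not_lt.2 ?_)
  refine (hardValue_mono ((le_div_iff₀' hN).2 (not_lt.1 hle))).trans ?_
  have e : ((n : ℝ) + 1) * ((t + third s t / 3) / (n + 1)) = t + third s t / 3 := by field_simp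
  rw [hardValue_eq ht (by linarith) (by linarith), e, clamp_of_le (by linarith), add_zero]

theorem lt_of_hardValue_lt {n s t : ℕ} {y : ℝ} (ht : t ≤ n)
    (h : hardValue n s y < (t + 1) / ((n : ℝ) + 1)) :
    (n + 1) * y < t + (third s t + 1) / 3 := by
  by_contra hle
  have hN : (0 : ℝ) < n + 1 := by positivity
  have h0 := third_nonneg s t
  have h2 := third_le s t
  refine absurd h (not_lt.2 ?_)
  refine le_trans ?_ (hardValue_mono ((div_le_iff₀' hN).2 (not_lt.1 hle)))
  have e : ((n : ℝ) + 1) * ((t + (third s t + 1) / 3) / (n + 1)) = t + (third s t + 1) / 3 := by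
    field_simp
  rw [hardValue_eq ht (by linarith) (by linarith), e, clamp_of_ge (by linarith)]

/-- If player `i` has the valuation for rank `r i`, then every proportional allocation gives the
cake to the players in the order of their ranks. -/
theorem rank_order_eq {n : ℕ} (hn : 1 ≤ n) (r : Fin n → ℕ) (hr : Function.Injective r)
    (hr1 : ∀ i, 1 ≤ r i) (hrn : ∀ i, r i ≤ n) (A : Allocation n)
    (hA : A.Proportional fun i => hardValuation n (r i)) :
    ∀ j, r (A.order j) = j + 1 := by
  have hN : (0 : ℝ) < n + 1 := by positivity
  have hn0 : (0 : ℝ) < n := by exact_mod_cast hn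
  have hNn : 1 / ((n : ℝ) + 1) < 1 / n := one_div_lt_one_div_of_lt hn0 (by linarith)
  have hstep : ∀ j : Fin n, hardValue n (r (A.order j)) (A.bdry j.castSucc) + 1 / (n : ℝ) ≤
      hardValue n (r (A.order j)) (A.bdry j.succ) := by
    intro j
    have h := hA (A.order j)
    rw [Allocation.piece, Equiv.symm_apply_apply, Allocation.value_slice, hardValuation_value,
      hardValuation_value] at h
    linarith
  -- Every piece is worth more than a zone to its owner, so each boundary advances by at least one
  -- zone; counting from the right end gives the upper bound `hupp`.
  have hlow : ∀ t : Fin (n + 1), ((t : ℕ) : ℝ) / (n + 1) ≤ A.bdry t := by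
    intro t
    induction t using Fin.induction with
    | zero => simp [A.first]
    | succ j ih =>
      have h1 := hstep j
      have h2 := hardValue_mono (n := n) (s := r (A.order j)) ih
      rw [hardValue_div (by omega)] at h2
      by_contra hlt
      have h3 := hardValue_mono (n := n) (s := r (A.order j)) (not_le.1 hlt).le
      rw [hardValue_div (by omega)] at h3
      simp only [Fin.val_succ, Fin.val_castSucc, Nat.cast_add, Nat.cast_one, add_div] at h2 h3
      linarith
  have hupp : ∀ t : Fin (n + 1), A.bdry t ≤ (((t : ℕ) + 1 : ℕ) : ℝ) / (n + 1) := by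
    intro t
    induction t using Fin.reverseInduction with
    | last =>
      rw [A.last, Fin.val_last]
      push_cast
      rw [div_self hN.ne']
    | cast j ih =>
      have h1 := hstep j
      have h2 := hardValue_mono (n := n) (s := r (A.order j)) ih
      rw [hardValue_div (by have := j.succ.2; omega)] at h2
      by_contra hlt
      have h3 := hardValue_mono (n := n) (s := r (A.order j)) (not_le.1 hlt).le
      rw [hardValue_div (by have := j.2; simp only [Fin.val_castSucc]; omega)] at h3
      simp only [Fin.val_succ, Fin.val_castSucc, Nat.cast_add, Nat.cast_one, add_div] at h2 h3
      linarith
  have hL : ∀ j : Fin n, (((j : ℕ) + 1 : ℕ) : ℝ) / (n + 1) <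
      hardValue n (r (A.order j)) (A.bdry j.succ) := by
    intro j
    have h1 := hstep j
    have h2 := hardValue_mono (n := n) (s := r (A.order j)) (hlow j.castSucc)
    rw [hardValue_div (by omega)] at h2
    simp only [Fin.val_castSucc] at h2
    push_cast
    rw [add_div]
    linarith
  have hU : ∀ j : Fin n, hardValue n (r (A.order j)) (A.bdry j.castSucc) <
      (((j : ℕ) : ℝ) + 1) / (n + 1) := by
    intro j
    have h1 := hstep j
    have h2 := hardValue_mono (n := n) (s := r (A.order j)) (hupp j.succ)
    rw [hardValue_div (by have := j.succ.2; omega)] at h2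
    simp only [Fin.val_succ] at h2
    push_cast at h2
    rw [add_div, add_div] at h2
    rw [add_div]
    linarith
  -- Boundary `t + 1` lies after the start of the left neighbour's liked third and before the end of
  -- the right neighbour's, so the latter third is not further left. Hence a rank too high for
  -- position `t` is followed by one too high for position `t + 1`.
  have hnext : ∀ t (h : t + 1 < n), t + 2 ≤ r (A.order ⟨t, by omega⟩) →
      t + 3 ≤ r (A.order ⟨t + 1, h⟩) := by
    intro t h hs
    have h1 := lt_of_lt_hardValue (by simp only; omega) (hL ⟨t, by omega⟩)
    have h2 := lt_of_hardValue_lt (by simp only; omega) (hU ⟨t + 1, h⟩)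
    simp only [Fin.succ_mk, Fin.castSucc_mk] at h1 h2
    have h3 : third (r (A.order ⟨t, by omega⟩)) (t + 1) <
        third (r (A.order ⟨t + 1, h⟩)) (t + 1) + 1 := by linarith
    have hne : r (A.order ⟨t, by omega⟩) ≠ r (A.order ⟨t + 1, h⟩) := fun he => by
      have := A.order.injective (hr he)
      simp at this
    unfold third at h3
    by_contra hlt
    rcases Nat.lt_or_ge (r (A.order ⟨t + 1, h⟩)) (t + 1 + 1) with h4 | h4
    · rw [compare_lt_iff_lt.2 h4] at h3
      rcases hs.eq_or_lt with h5 | h5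
      · rw [compare_eq_iff_eq.2 h5.symm] at h3
        norm_num [orderingCode] at h3
      · rw [compare_gt_iff_gt.2 h5] at h3
        norm_num [orderingCode] at h3
    · have h5 : r (A.order ⟨t + 1, h⟩) = t + 1 + 1 := by omega
      rw [compare_eq_iff_eq.2 h5, compare_gt_iff_gt.2 (by omega)] at h3
      norm_num [orderingCode] at h3
  -- Induction from the right end, where no rank exceeds `n`. Injectivity then turns all these
  -- inequalities into equalities.
  have hle : ∀ (m t : ℕ) (h : t < n), t + m + 1 = n → r (A.order ⟨t, h⟩) ≤ t + 1 := by
    intro m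
    induction m with
    | zero =>
      intro t h ht
      have := hrn (A.order ⟨t, h⟩)
      omega
    | succ m ih =>
      intro t h ht
      have h1 := ih (t + 1) (by omega) (by omega)
      by_contra hlt
      have := hnext t (by omega) (by omega)
      omega
  have hle' : ∀ j : Fin n, r (A.order j) ≤ j + 1 := fun j =>
    hle (n - 1 - j) j j.2 (by have := j.2; omega)
  have heq : ∀ (t : ℕ) (h : t < n), r (A.order ⟨t, h⟩) = t + 1 := by
    intro t
    induction t using Nat.strong_induction_on with
    | _ t ih =>
      intro h
      by_contra hne
      have h1 := hle' ⟨t, h⟩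
      have h2 := hr1 (A.order ⟨t, h⟩)
      simp only at h1
      have h3 := ih (r (A.order ⟨t, h⟩) - 1) (by omega) (by omega)
      have h4 := A.order.injective (hr (h3.trans (Nat.sub_add_cancel h2)))
      have h5 := congrArg Fin.val h4
      simp only at h5
      omega
  exact fun j => heq j j.2

/-! ### Ranks -/

theorem one_le_rank {n : ℕ} (x : Fin n → ℝ) (i : Fin n) : 1 ≤ rank x i :=
  Finset.card_pos.2 ⟨i, by simp⟩

theorem rank_le {n : ℕ} (x : Fin n → ℝ) (i : Fin n) : rank x i ≤ n :=
  (Finset.card_le_univ _).trans_eq (Fintype.card_fin n)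

theorem lt_of_rank_lt {n : ℕ} {x : Fin n → ℝ} {i j : Fin n} (h : rank x i < rank x j) :
    x i < x j := by
  by_contra hle
  refine absurd h (not_lt.2 (Finset.card_le_card fun a ha => ?_))
  simp only [Finset.mem_filter, Finset.mem_univ, true_and] at ha ⊢
  exact ha.trans (not_lt.1 hle)

theorem rank_injective {n : ℕ} {x : Fin n → ℝ} (hx : Function.Injective x) :
    Function.Injective (rank x) := by
  intro i j hij
  have h : ∀ {i j}, rank x i = rank x j → x i ≤ x j := by
    intro i j hij
    by_contra hlt
    refine absurd hij (ne_of_gt (Finset.card_lt_card ?_))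
    refine Finset.ssubset_iff_subset_ne.2 ⟨fun a ha => ?_, fun he => ?_⟩
    · simp only [Finset.mem_filter, Finset.mem_univ, true_and] at ha ⊢
      exact ha.trans (not_le.1 hlt).le
    · have : i ∈ Finset.univ.filter fun a => x a ≤ x j := by rw [he]; simp
      exact hlt (Finset.mem_filter.1 this).2
  exact hx (le_antisymm (h hij) (h hij.symm))

/-! ### Translation of queries and answers -/

namespace RWQuery

variable {n : ℕ}

def player : RWQuery n → Fin n
  | cut i _ => i
  | eval i _ => i

def param : RWQuery n → ℝ
  | cut _ α => α
  | eval _ y => y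

/-- The number of the zone that a query is about, starting from `1`. -/
def zone (q : RWQuery n) : ℕ := max 1 ⌈((n : ℝ) + 1) * q.param⌉₊

/-- The rank query that tells which third of the zone the player likes. -/
def toRank (q : RWQuery n) : RankQuery n := ⟨q.player, q.zone⟩

/-- The answer to a query, computed from the answer to its rank query. -/
def translate : RWQuery n → Ordering → ℝ
  | cut i α, o =>
      if (n + 1) * α ≤ 0 then 0
      else (((n + 1) * α - ((cut i α).zone - 1) + (orderingCode o + 1)) / 3
        + ((cut i α).zone - 1)) / ((n : ℝ) + 1)
  | eval i y, o =>
      (clamp (((n + 1) * y - ((eval i y).zone - 1)) * 3 - (orderingCode o + 1))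
        + ((eval i y).zone - 1)) / ((n : ℝ) + 1)

end RWQuery

/-- The players behind a list of items. -/
def hardPlayers {n : ℕ} (x : Fin n → ℝ) (i : Fin n) : Valuation := hardValuation n (rank x i)

/-- A cut value and an eval point use the same formula for the zone, since each zone has equal
length and value. The cut at value 0 is exceptional: its leftmost point is 0, not the start of a
liked third. -/
theorem rwOracle_hardPlayers {n : ℕ} (x : Fin n → ℝ) (q : RWQuery n)
    (hq : q.param ∈ Set.Icc (0 : ℝ) 1) :
    rwOracle (hardPlayers x) q = q.translate (rankOracle x q.toRank) := by
  have hN : (0 : ℝ) < n + 1 := by positivity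
  obtain ⟨j, hj⟩ : ∃ j, q.zone = j + 1 :=
    ⟨q.zone - 1, (Nat.sub_add_cancel (le_max_left _ _)).symm⟩
  have hle : ((n : ℝ) + 1) * q.param ≤ j + 1 := by
    have : (⌈((n : ℝ) + 1) * q.param⌉₊ : ℝ) ≤ q.zone :=
      Nat.cast_le.2 (le_max_right _ _)
    rw [hj] at this
    push_cast at this
    exact (Nat.le_ceil _).trans this
  have hlt : j = 0 ∨ (j : ℝ) < (n + 1) * q.param := by
    rcases Nat.eq_zero_or_pos j with h | h
    · exact Or.inl h
    · refine Or.inr (Nat.lt_ceil.1 ?_)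
      have : max 1 ⌈((n : ℝ) + 1) * q.param⌉₊ = j + 1 := hj
      omega
  have hjn : j ≤ n := by
    have h1 : ⌈((n : ℝ) + 1) * q.param⌉₊ ≤ n + 1 := by
      rw [Nat.ceil_le]
      push_cast
      nlinarith [hq.2]
    have : max 1 ⌈((n : ℝ) + 1) * q.param⌉₊ = j + 1 := hj
    omega
  have hthird : ∀ i, q.player = i →
      orderingCode (rankOracle x q.toRank) + 1 = third (rank x i) j := by
    rintro i rfl
    simp only [rankOracle, RWQuery.toRank, third, hj]
  cases q with
  | cut i α =>
    simp only [rwOracle, RWQuery.translate, hardPlayers, hthird i rfl, hj]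
    simp only [RWQuery.param] at hle hlt hq
    split_ifs with h0
    · have : α = 0 := by
        have h1 : 0 ≤ ((n : ℝ) + 1) * α := mul_nonneg hN.le hq.1
        rcases mul_eq_zero.1 (le_antisymm h0 h1) with h | h
        · exact absurd h hN.ne'
        · exact h
      simp [this, hardValuation_cutPoint_zero]
    · rw [hardValuation_cutPoint hjn ?_ hle]
      · push_cast
        ring
      · rcases hlt with rfl | h
        · simpa using h0
        · exact h
  | eval i y =>
    simp only [rwOracle, RWQuery.translate, hardPlayers, hthird i rfl, hj, hardValuation_value]
    simp only [RWQuery.param] at hle hlt hq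
    rw [hardValue_eq hjn ?_ hle]
    · push_cast
      ring_nf
    · rcases hlt with rfl | h
      · simpa using mul_nonneg hN.le hq.1
      · exact h.le

/-- The sorting algorithm behind a cake cutting protocol. -/
def RWProtocol.toSort {n : ℕ} : RWProtocol n → SortAlg n
  | .done A => .done A.order
  | .round qs next => .round (qs.map RWQuery.toRank) fun os =>
      RWProtocol.toSort (next (List.zipWith RWQuery.translate qs os))

theorem zipWith_translate {n : ℕ} (x : Fin n → ℝ) (qs : List (RWQuery n))
    (hqs : ∀ q ∈ qs, q.param ∈ Set.Icc (0 : ℝ) 1) :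
    List.zipWith RWQuery.translate qs ((qs.map RWQuery.toRank).map (rankOracle x)) =
      qs.map (rwOracle (hardPlayers x)) := by
  induction qs with
  | nil => rfl
  | cons q qs ih =>
    simp only [List.map_cons, List.zipWith_cons_cons, List.cons.injEq]
    exact ⟨(rwOracle_hardPlayers x q (hqs q (by simp))).symm,
      ih fun p hp => hqs p (List.mem_cons_of_mem _ hp)⟩

theorem RWQuery.Admissible.param_mem {n : ℕ} {cuts : Set ℝ} (hc : cuts ⊆ Set.Icc 0 1)
    {q : RWQuery n} (h : q.Admissible cuts) : q.param ∈ Set.Icc (0 : ℝ) 1 := by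
  cases q with
  | cut i α => exact h
  | eval i y => exact hc h

theorem cuts_union_subset {n : ℕ} (V : Fin n → Valuation) {cuts : Set ℝ}
    (hc : cuts ⊆ Set.Icc 0 1) {qs : List (RWQuery n)} (hqs : ∀ q ∈ qs, q.Admissible cuts) :
    cuts ∪ {y | ∃ i α, RWQuery.cut i α ∈ qs ∧ y = (V i).cutPoint α} ⊆ Set.Icc 0 1 := by
  rintro y (hy | ⟨i, α, h, rfl⟩)
  · exact hc hy
  · exact ((V i).isLeast_cutPoint (hqs _ h)).1.1

/-- Legality keeps every parameter in `[0, 1]`, so the translated answers are those of the hard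
players and both runs follow the same branch. -/
theorem RWProtocol.toSort_run {n : ℕ} (x : Fin n → ℝ) (P : RWProtocol n) :
    ∀ cuts ⊆ Set.Icc (0 : ℝ) 1, RWProtocol.Legal (hardPlayers x) cuts P →
      P.toSort.output (rankOracle x) = (P.output (rwOracle (hardPlayers x))).order ∧
      P.toSort.rounds (rankOracle x) = P.rounds (rwOracle (hardPlayers x)) ∧
      P.toSort.queries (rankOracle x) = P.queries (rwOracle (hardPlayers x)) := by
  induction P with
  | done A => exact fun _ _ _ => ⟨rfl, rfl, rfl⟩
  | round qs next ih =>
    rintro cuts hc ⟨hadm, hlegal⟩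
    obtain ⟨h1, h2, h3⟩ := ih _ _ (cuts_union_subset _ hc hadm) hlegal
    have hz := zipWith_translate x qs fun q hq => (hadm q hq).param_mem hc
    simp only [RWProtocol.toSort, RoundAlg.output, RoundAlg.rounds, RoundAlg.queries, hz,
      List.length_map, h1, h2, h3, and_self]

theorem RWProtocol.Solves.toSort {n : ℕ} {P : RWProtocol n} {k q : ℕ} (hn : 1 ≤ n)
    (hP : P.Solves k q) : P.toSort.Solves k q := by
  intro x hx
  obtain ⟨hlegal, hprop, hk, hq⟩ := hP (hardPlayers x)
  obtain ⟨h1, h2, h3⟩ := P.toSort_run x ∅ (by simp) hlegal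
  rw [h1, h2, h3]
  refine ⟨fun i j hij => lt_of_rank_lt ?_, hk, hq⟩
  have h := rank_order_eq hn (rank x) (rank_injective hx) (one_le_rank x) (rank_le x) _ hprop
  rw [h, h]
  exact Nat.add_lt_add_right hij 1

/-! ### The machine that carries out the reduction -/

/-- Started with memory `M`, the program stops after at most `T` steps, with a memory that
satisfies `Q`. -/
def Cmd.Ensures (c : Cmd) (M : Mem) (T : ℕ) (Q : Mem → Prop) : Prop :=
  ∃ t ≤ T, ∃ M', c.Runs M t M' ∧ Q M'

namespace Cmd

variable {M : Mem} {Q : Mem → Prop}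

theorem Ensures.mono {c : Cmd} {T T' : ℕ} {Q' : Mem → Prop} (h : c.Ensures M T Q) (hT : T ≤ T')
    (hQ : ∀ M', Q M' → Q' M') : c.Ensures M T' Q' := by
  obtain ⟨t, ht, M', hr, hM'⟩ := h
  exact ⟨t, ht.trans hT, M', hr, hQ M' hM'⟩

theorem ensures_skip (h : Q M) : Cmd.skip.Ensures M 1 Q := ⟨1, le_rfl, M, .skip M, h⟩

theorem ensures_const {d : ℕ} {c : ℤ} (h : Q (Function.update M d c)) :
    (Cmd.const d c).Ensures M 1 Q := ⟨1, le_rfl, _, .const M d c, h⟩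

theorem ensures_plus {d a b : ℕ} (h : Q (Function.update M d (M a + M b))) :
    (Cmd.arith .plus d a b).Ensures M 1 Q :=
  ⟨1, le_rfl, _, .arith M .plus d a b _ (.plus _ _), h⟩

theorem ensures_minus {d a b : ℕ} (h : Q (Function.update M d (M a - M b))) :
    (Cmd.arith .minus d a b).Ensures M 1 Q :=
  ⟨1, le_rfl, _, .arith M .minus d a b _ (.minus _ _), h⟩

theorem ensures_times {d a b : ℕ} (h : Q (Function.update M d (M a * M b))) :
    (Cmd.arith .times d a b).Ensures M 1 Q :=
  ⟨1, le_rfl, _, .arith M .times d a b _ (.times _ _), h⟩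

theorem ensures_over {d a b : ℕ} (hb : M b ≠ 0) (h : Q (Function.update M d (M a / M b))) :
    (Cmd.arith .over d a b).Ensures M 1 Q :=
  ⟨1, le_rfl, _, .arith M .over d a b _ (.over _ _ hb), h⟩

theorem ensures_seq {c₁ c₂ : Cmd} {T₁ T₂ : ℕ}
    (h : c₁.Ensures M T₁ fun M₁ => c₂.Ensures M₁ T₂ Q) :
    (Cmd.seq c₁ c₂).Ensures M (T₁ + T₂) Q := by
  obtain ⟨t₁, ht₁, M₁, hr₁, t₂, ht₂, M₂, hr₂, hQ⟩ := h
  exact ⟨t₁ + t₂, Nat.add_le_add ht₁ ht₂, M₂, .seq _ _ _ _ _ _ _ hr₁ hr₂, hQ⟩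

theorem ensures_cond {a b : ℕ} {c₁ c₂ : Cmd} {T : ℕ} (h₁ : M a ≤ M b → c₁.Ensures M T Q)
    (h₂ : ¬ M a ≤ M b → c₂.Ensures M T Q) : (Cmd.cond a b c₁ c₂).Ensures M (1 + T) Q := by
  by_cases h : M a ≤ M b
  · obtain ⟨t, ht, M', hr, hQ⟩ := h₁ h
    exact ⟨1 + t, Nat.add_le_add_left ht 1, M', .condTrue _ _ _ _ _ _ _ h hr, hQ⟩
  · obtain ⟨t, ht, M', hr, hQ⟩ := h₂ h
    exact ⟨1 + t, Nat.add_le_add_left ht 1, M', .condFalse _ _ _ _ _ _ _ h hr, hQ⟩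

/-- Counts register `12` up to the ceiling of register `10`. -/
theorem ensures_count (T : ℕ) : ∀ (M : Mem) (j : ℕ), M 8 = 1 → M 12 = j → M 10 ≤ j + T →
    (Cmd.loop 12 10 (.arith .plus 12 12 8)).Ensures M (2 * T + 1) fun M' =>
      M' = Function.update M 12 ((max j ⌈M 10⌉₊ : ℕ) : ℝ) := by
  induction T with
  | zero =>
    intro M j _ hj hT
    simp only [Nat.cast_zero, add_zero] at hT
    refine ⟨1, le_rfl, M, .loopExit _ _ _ _ (by rw [hj]; exact not_lt.2 hT), ?_⟩
    rw [max_eq_left (Nat.ceil_le.2 hT), ← hj, Function.update_eq_self]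
  | succ T ih =>
    intro M j h8 hj hT
    by_cases hlt : M 12 < M 10
    · obtain ⟨t, ht, M', hr, rfl⟩ := ih (Function.update M 12 (M 12 + M 8)) (j + 1)
        (by simpa using h8) (by simp [hj, h8]) (by simp; push_cast at hT; linarith)
      refine ⟨1 + 1 + t, by omega, _, .loopStep _ _ _ _ _ _ 1 t hlt
        (.arith _ _ _ _ _ _ (.plus _ _)) hr, ?_⟩
      have h10 : Function.update M 12 (M 12 + M 8) 10 = M 10 := by simp
      have hceil : j < ⌈M 10⌉₊ := Nat.lt_ceil.2 (hj ▸ hlt)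
      rw [Function.update_idem, h10, max_eq_right (Nat.succ_le_of_lt hceil), max_eq_right hceil.le]
    · refine ⟨1, by omega, M, .loopExit _ _ _ _ hlt, ?_⟩
      rw [hj] at hlt
      rw [max_eq_left (Nat.ceil_le.2 (not_lt.1 hlt)), ← hj, Function.update_eq_self]

end Cmd

/-- Finds the zone of the cake that a query is about. -/
def zoneCmd : Cmd :=
  .seq (.const 8 1) <| .seq (.arith .plus 9 0 8) <| .seq (.arith .times 10 9 3) <|
  .seq (.const 12 1) <| .loop 12 10 (.arith .plus 12 12 8)

/-- Adding register `13`, which holds 0, serves as a move instruction. -/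
def askCmd : Cmd :=
  .seq zoneCmd <| .seq (.const 13 0) <| .seq (.arith .plus 5 2 13) <| .arith .plus 6 12 13

/-- For this program and the next, registers `8`, `13` and `14` hold 1, 0 and 3, register `9` holds
`n + 1`, `15` the liked third, `16` the zone counted from 0, and `17` the scaled parameter relative
to that zone. -/
def cutCmd : Cmd :=
  .cond 10 13 (.const 7 0) <|
  .seq (.arith .plus 17 17 15) <| .seq (.arith .over 17 17 14) <|
  .seq (.arith .plus 17 17 16) <| .arith .over 7 17 9

def evalCmd : Cmd :=
  .seq (.arith .times 17 17 14) <| .seq (.arith .minus 17 17 15) <|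
  -- The function `clamp`, carried out by two comparisons.
  .seq (.cond 17 13 (.const 17 0) <| .cond 17 8 .skip (.const 17 1)) <|
  .seq (.arith .plus 17 17 16) <| .arith .over 7 17 9

def answerCmd : Cmd :=
  .seq zoneCmd <| .seq (.const 13 0) <| .seq (.const 14 3) <| .seq (.arith .plus 15 4 8) <|
  .seq (.arith .minus 16 12 8) <| .seq (.arith .minus 17 10 16) <| .cond 1 13 cutCmd evalCmd

/-- The reduction from sorting to proportional cake cutting. -/
def sortReduction : Reduction := ⟨askCmd, answerCmd⟩

section Registers

variable {n : ℕ} (M : Mem) (q : RWQuery n)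

theorem loadQuery_zero : loadQuery M q 0 = M 0 := by cases q <;> simp [loadQuery]

theorem loadQuery_two : loadQuery M q 2 = ((q.player : ℕ) : ℝ) := by
  cases q <;> simp [loadQuery, RWQuery.player]

theorem loadQuery_three : loadQuery M q 3 = q.param := by
  cases q <;> simp [loadQuery, RWQuery.param]

theorem loadAnswer_of_ne (o : Ordering) {r : ℕ} (hr : r ≠ 4) : loadAnswer M o r = M r := by
  simp [loadAnswer, hr]

theorem loadAnswer_four (o : Ordering) : loadAnswer M o 4 = orderingCode o := by
  simp [loadAnswer]

end Registers

theorem zoneCmd_ensures {n : ℕ} (q : RWQuery n) (M : Mem) (h0 : M 0 = n) (h3 : M 3 = q.param)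
    (hq : q.param ≤ 1) :
    zoneCmd.Ensures M (2 * n + 5) fun M' => M' 8 = 1 ∧ M' 9 = n + 1 ∧
      M' 10 = (n + 1) * q.param ∧ M' 12 = q.zone ∧ ∀ r < 8, M' r = M r := by
  have hu : ((n : ℝ) + 1) * q.param ≤ n + 1 := by
    have : (0 : ℝ) ≤ n + 1 := by positivity
    nlinarith
  refine Cmd.Ensures.mono (Cmd.ensures_seq <| Cmd.ensures_const <| Cmd.ensures_seq <|
    Cmd.ensures_plus <| Cmd.ensures_seq <| Cmd.ensures_times <| Cmd.ensures_seq <|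
    Cmd.ensures_const <| Cmd.Ensures.mono (Cmd.ensures_count n _ 1 ?_ ?_ ?_) le_rfl ?_)
    (by omega : _ ≤ 2 * n + 5) fun _ h => h
  · simp
  · simp
  · simp [h0, h3]
    linarith
  · rintro _ rfl
    refine ⟨by simp, by simp [h0], by simp [h0, h3], by simp [h0, h3, RWQuery.zone], ?_⟩
    intro r hr
    have h8 : r ≠ 8 := by omega
    have h9 : r ≠ 9 := by omega
    have h10 : r ≠ 10 := by omega
    have h12 : r ≠ 12 := by omega
    simp [h8, h9, h10, h12]

/-- Only register `0` has to survive from one query to the next: the zone is computed afresh when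
the answer arrives. -/
theorem askCmd_ensures {n : ℕ} (q : RWQuery n) (M : Mem) (h0 : M 0 = n) (hq : q.param ≤ 1) :
    askCmd.Ensures (loadQuery M q) (2 * n + 8) fun M' =>
      M' 5 = ((q.toRank.item : ℕ) : ℝ) ∧ M' 6 = (q.toRank.threshold : ℝ) ∧ M' 0 = n := by
  refine Cmd.ensures_seq (T₂ := 3) <| Cmd.Ensures.mono (zoneCmd_ensures q _
    ((loadQuery_zero M q).trans h0) (loadQuery_three M q) hq) le_rfl fun M' hM' => ?_
  obtain ⟨-, -, -, h12, hr⟩ := hM'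
  refine Cmd.ensures_seq (T₁ := 1) <| Cmd.ensures_const <| Cmd.ensures_seq (T₁ := 1) <|
    Cmd.ensures_plus <| Cmd.ensures_plus ⟨?_, ?_, ?_⟩
  · simp [hr 2 (by norm_num), loadQuery_two, RWQuery.toRank]
  · simp [h12, RWQuery.toRank]
  · simp [hr 0 (by norm_num), loadQuery_zero, h0]

theorem cutCmd_ensures {n : ℕ} (i : Fin n) (α : ℝ) (o : Ordering) (M : Mem) (h0 : M 0 = n)
    (h9 : M 9 = n + 1) (h10 : M 10 = (n + 1) * α) (h13 : M 13 = 0) (h14 : M 14 = 3)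
    (h15 : M 15 = orderingCode o + 1) (h16 : M 16 = (RWQuery.cut i α).zone - 1)
    (h17 : M 17 = (n + 1) * α - ((RWQuery.cut i α).zone - 1)) :
    cutCmd.Ensures M 5 fun M' => M' 7 = (RWQuery.cut i α).translate o ∧ M' 0 = n := by
  have hN : (n : ℝ) + 1 ≠ 0 := by positivity
  refine Cmd.ensures_cond (T := 4) (fun h => ?_) fun h => ?_
  · refine Cmd.Ensures.mono (Cmd.ensures_const (Q := fun M' => M' 7 = _ ∧ M' 0 = _) ⟨?_, ?_⟩)
      (by norm_num) fun _ h => h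
    · rw [h10, h13] at h
      simp [RWQuery.translate, h]
    · simp [h0]
  · refine Cmd.ensures_seq (T₁ := 1) <| Cmd.ensures_plus <| Cmd.ensures_seq (T₁ := 1) <|
      Cmd.ensures_over ?_ <| Cmd.ensures_seq (T₁ := 1) <| Cmd.ensures_plus <|
      Cmd.ensures_over ?_ ⟨?_, ?_⟩
    · simp [h14]
    · simpa [h9] using hN
    · rw [h10, h13] at h
      simp [RWQuery.translate, h, h9, h14, h15, h16, h17]
    · simp [h0]

theorem evalCmd_ensures {n : ℕ} (i : Fin n) (y : ℝ) (o : Ordering) (M : Mem) (h0 : M 0 = n)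
    (h8 : M 8 = 1) (h9 : M 9 = n + 1) (h13 : M 13 = 0) (h14 : M 14 = 3)
    (h15 : M 15 = orderingCode o + 1) (h16 : M 16 = (RWQuery.eval i y).zone - 1)
    (h17 : M 17 = (n + 1) * y - ((RWQuery.eval i y).zone - 1)) :
    evalCmd.Ensures M 7 fun M' => M' 7 = (RWQuery.eval i y).translate o ∧ M' 0 = n := by
  have hN : (n : ℝ) + 1 ≠ 0 := by positivity
  set w := ((n + 1) * y - ((RWQuery.eval i y).zone - 1)) * 3 - (orderingCode o + 1) with hw
  refine Cmd.ensures_seq (T₁ := 1) <| Cmd.ensures_times <| Cmd.ensures_seq (T₁ := 1) <|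
    Cmd.ensures_minus <| Cmd.ensures_seq (T₁ := 3) (T₂ := 2) ?_
  set M₁ := Function.update (Function.update M 17 (M 17 * M 14)) 17
    (Function.update M 17 (M 17 * M 14) 17 - Function.update M 17 (M 17 * M 14) 15) with hM₁
  have k17 : M₁ 17 = w := by simp [hM₁, hw, h14, h15, h17]
  have k : ∀ r, r ≠ 17 → M₁ r = M r := fun r hr => by simp [hM₁, hr]
  have hrest : ∀ M₂ : Mem, M₂ 17 = clamp w → (∀ r, r ≠ 17 → M₂ r = M r) →
      (Cmd.seq (.arith .plus 17 17 16) (.arith .over 7 17 9)).Ensures M₂ 2 fun M' =>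
        M' 7 = (RWQuery.eval i y).translate o ∧ M' 0 = n := by
    intro M₂ e17 e
    refine Cmd.ensures_seq (T₁ := 1) <| Cmd.ensures_plus <| Cmd.ensures_over ?_ ⟨?_, ?_⟩
    · simpa [e, h9] using hN
    · simp [RWQuery.translate, e17, e, h9, h16, hw]
    · simp [e, h0]
  refine Cmd.ensures_cond (T := 2) (fun h => ?_) fun h => ?_
  · rw [k17, k 13 (by norm_num), h13] at h
    refine Cmd.Ensures.mono (Cmd.ensures_const (Q := fun M' => Cmd.Ensures _ M' 2 _)
      (hrest _ ?_ ?_)) (by norm_num) fun _ h => h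
    · simp [clamp_of_le h]
    · intro r hr
      simp [hr, k]
  · rw [k17, k 13 (by norm_num), h13] at h
    refine Cmd.ensures_cond (T := 1) (fun h' => ?_) fun h' => ?_
    · rw [k17, k 8 (by norm_num), h8] at h'
      refine Cmd.ensures_skip (hrest _ ?_ k)
      rw [k17, clamp_of_mem (not_le.1 h).le h']
    · rw [k17, k 8 (by norm_num), h8] at h'
      refine Cmd.ensures_const (hrest _ ?_ ?_)
      · simp [clamp_of_ge (not_le.1 h').le]
      · intro r hr
        simp [hr, k]

theorem answerCmd_ensures {n : ℕ} (q : RWQuery n) (o : Ordering) (M : Mem) (h0 : M 0 = n)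
    (hq : q.param ≤ 1) :
    answerCmd.Ensures (loadAnswer (loadQuery M q) o) (2 * n + 18) fun M' =>
      M' 7 = q.translate o ∧ M' 0 = n := by
  refine Cmd.ensures_seq (T₂ := 13) <| Cmd.Ensures.mono (zoneCmd_ensures q _ ?_ ?_ hq) le_rfl
    fun M₁ hM₁ => ?_
  · rw [loadAnswer_of_ne _ _ (by norm_num), loadQuery_zero, h0]
  · rw [loadAnswer_of_ne _ _ (by norm_num), loadQuery_three]
  obtain ⟨h8, h9, h10, h12, hr⟩ := hM₁
  have h4 := (hr 4 (by norm_num)).trans (loadAnswer_four _ o)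
  have h1 := (hr 1 (by norm_num)).trans (loadAnswer_of_ne _ o (by norm_num))
  have h0' := ((hr 0 (by norm_num)).trans (loadAnswer_of_ne _ o (by norm_num))).trans
    ((loadQuery_zero M q).trans h0)
  refine Cmd.ensures_seq (T₂ := 12) <| Cmd.ensures_const <| Cmd.ensures_seq (T₂ := 11) <|
    Cmd.ensures_const <| Cmd.ensures_seq (T₂ := 10) <| Cmd.ensures_plus <|
    Cmd.ensures_seq (T₂ := 9) <| Cmd.ensures_minus <| Cmd.ensures_seq (T₂ := 8) <|
    Cmd.ensures_minus ?_
  generalize hM₂ : Function.update (α := ℕ) (β := fun _ => ℝ) _ 17 _ = M₂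
  have k13 : M₂ 13 = 0 := by simp [← hM₂]
  have k14 : M₂ 14 = 3 := by simp [← hM₂]
  have k15 : M₂ 15 = orderingCode o + 1 := by simp [← hM₂, h4, h8]
  have k16 : M₂ 16 = q.zone - 1 := by simp [← hM₂, h12, h8]
  have k17 : M₂ 17 = (n + 1) * q.param - (q.zone - 1) := by simp [← hM₂, h12, h8, h10]
  have k : ∀ r < 13, M₂ r = M₁ r := fun r hr => by
    have e13 : r ≠ 13 := by omega
    have e14 : r ≠ 14 := by omega
    have e15 : r ≠ 15 := by omega
    have e16 : r ≠ 16 := by omega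
    have e17 : r ≠ 17 := by omega
    simp [← hM₂, e13, e14, e15, e16, e17]
  have k0 := (k 0 (by norm_num)).trans h0'
  have k1 := (k 1 (by norm_num)).trans h1
  have k8 := (k 8 (by norm_num)).trans h8
  have k9 := (k 9 (by norm_num)).trans h9
  have k10 := (k 10 (by norm_num)).trans h10
  refine Cmd.ensures_cond (T := 7) (fun h => ?_) fun h => ?_
  · rw [k1, k13] at h
    cases q with
    | cut i α =>
      exact (cutCmd_ensures i α o M₂ k0 k9 k10 k13 k14 k15 k16 k17).mono (by norm_num)
        fun _ h => h
    | eval i y => norm_num [loadQuery] at h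
  · rw [k1, k13] at h
    cases q with
    | cut i α => norm_num [loadQuery] at h
    | eval i y => exact evalCmd_ensures i y o M₂ k0 k8 k9 k13 k14 k15 k16 k17

theorem exists_askAll {n : ℕ} (qs : List (RWQuery n)) (hqs : ∀ q ∈ qs, q.param ≤ 1) :
    ∀ M : Mem, M 0 = n → ∃ t M', AskAll askCmd qs M (qs.map RWQuery.toRank) t M' ∧ M' 0 = n ∧
      t ≤ (2 * n + 8) * qs.length := by
  induction qs with
  | nil => exact fun M h0 => ⟨0, M, .nil M, h0, Nat.zero_le _⟩
  | cons q qs ih =>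
    intro M h0
    obtain ⟨t₁, ht₁, M₁, hr, h5, h6, h0'⟩ := askCmd_ensures q M h0 (hqs q (by simp))
    obtain ⟨t₂, M₂, ha, h0'', ht₂⟩ := ih (fun p hp => hqs p (List.mem_cons_of_mem _ hp)) M₁ h0'
    refine ⟨t₁ + t₂, M₂, .cons _ _ _ _ _ _ _ _ _ hr h5 h6 ha, h0'', ?_⟩
    rw [List.length_cons, mul_add, mul_one]
    omega

theorem exists_answerAll {n : ℕ} (qs : List (RWQuery n)) (hqs : ∀ q ∈ qs, q.param ≤ 1) :
    ∀ (os : List Ordering) (M : Mem), M 0 = n →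
      ∃ t M', AnswerAll answerCmd (qs.zip os) M (List.zipWith RWQuery.translate qs os) t M' ∧
        M' 0 = n ∧ t ≤ (2 * n + 18) * qs.length := by
  induction qs with
  | nil => exact fun os M h0 => ⟨0, M, by simpa using .nil M, h0, Nat.zero_le _⟩
  | cons q qs ih =>
    intro os M h0
    cases os with
    | nil => exact ⟨0, M, by simpa using .nil M, h0, Nat.zero_le _⟩
    | cons o os =>
      obtain ⟨t₁, ht₁, M₁, hr, h7, h0'⟩ := answerCmd_ensures q o M h0 (hqs q (by simp))
      obtain ⟨t₂, M₂, ha, h0'', ht₂⟩ :=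
        ih (fun p hp => hqs p (List.mem_cons_of_mem _ hp)) os M₁ h0'
      refine ⟨t₁ + t₂, M₂, ?_, h0'', ?_⟩
      · rw [List.zip_cons_cons, List.zipWith_cons_cons, ← h7]
        exact .cons _ _ _ _ _ _ _ _ _ hr ha
      · rw [List.length_cons, mul_add, mul_one]
        omega

/-- A query costs at most `2 * n + 8` steps for asking and `2 * n + 18` for answering. -/
theorem exists_executes {n : ℕ} (x : Fin n → ℝ) (P : RWProtocol n) :
    ∀ cuts ⊆ Set.Icc (0 : ℝ) 1, RWProtocol.Legal (hardPlayers x) cuts P → ∀ M : Mem, M 0 = n →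
      ∃ t, sortReduction.Executes (rankOracle x) P P.toSort M t ∧
        t ≤ (4 * n + 26) * P.toSort.queries (rankOracle x) := by
  induction P with
  | done A => exact fun _ _ _ M _ => ⟨0, .done A M, Nat.zero_le _⟩
  | round qs next ih =>
    rintro cuts hc ⟨hadm, hlegal⟩ M h0
    have hqs := fun q hq => ((hadm q hq).param_mem hc)
    obtain ⟨t₁, M₁, h1, h1', ht₁⟩ := exists_askAll qs (fun q hq => (hqs q hq).2) M h0
    obtain ⟨t₂, M₂, h2, h2', ht₂⟩ := exists_answerAll qs (fun q hq => (hqs q hq).2)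
      ((qs.map RWQuery.toRank).map (rankOracle x)) M₁ h1'
    have hz := zipWith_translate x qs hqs
    obtain ⟨t₃, h3, ht₃⟩ := ih _ _ (cuts_union_subset _ hc hadm) hlegal M₂ h2'
    refine ⟨t₁ + t₂ + t₃, .round _ _ _ _ _ _ _ _ _ _ _ h1 h2 ?_, ?_⟩
    · rw [hz]
      exact h3
    · simp only [RWProtocol.toSort, RoundAlg.queries, hz, List.length_map]
      nlinarith

end CakeSort

end

/-! ### The equivalence of the two problems -/

theorem mainTheorem7 :
    -- a polynomial-time reduction from sorting to proportional cake cutting that preserves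
    -- the number of rounds and the number of queries
    (∃ (R : CakeSort.Reduction) (d : ℕ), ∀ (n k q : ℕ), 1 ≤ n → 1 ≤ k →
      ∀ P : CakeSort.RWProtocol n, P.Solves k q →
        ∃ S : CakeSort.SortAlg n, S.Solves k q ∧
          ∀ x : Fin n → ℝ, Function.Injective x →
            ∃ t : ℕ, R.Executes (CakeSort.rankOracle x) P S (CakeSort.initMem n) t ∧
              t ≤ d * (n + S.queries (CakeSort.rankOracle x)) ^ d) ∧
    -- conversely, proportional cake cutting is as easy as sorting, up to a universal constant
    (∃ c : ℕ, ∀ (n k q : ℕ), 1 ≤ n → 1 ≤ k →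
      (∃ S : CakeSort.SortAlg n, S.Solves k q) →
        ∃ P : CakeSort.RWProtocol n, P.Solves k (c * q)) := by
  -- The number 30 is needed as a factor, from `4 + 26`; as an exponent 2 would suffice.
  refine ⟨⟨CakeSort.sortReduction, 30, fun n k q hn _ P hP => ⟨P.toSort, hP.toSort hn, ?_⟩⟩,
    40, fun n k q hn hk ⟨S, hS⟩ => hS.exists_protocol hn hk⟩
  intro x _
  obtain ⟨t, ht, hle⟩ := CakeSort.exists_executes x P ∅ (by simp) (hP _).1 (CakeSort.initMem n)
    (by simp [CakeSort.initMem])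
  refine ⟨t, ht, hle.trans ?_⟩
  set m := P.toSort.queries (CakeSort.rankOracle x)
  calc (4 * n + 26) * m ≤ 30 * (n + m) ^ 2 := by nlinarith
    _ ≤ 30 * (n + m) ^ 30 :=
        Nat.mul_le_mul_left _ (Nat.pow_le_pow_right (by omega) (by norm_num))
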